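/- Let $n\ge 2$. A random walk on the four-dimensional torus $\mathbb{Z}_n^4=(\mathbb{Z}/n\mathbb{Z})^4$ is a Markov chain $(X_t)_{t\ge 0}$, with an arbitrary initial distribution, which at each step stays at its current position with probability $1/2$ and otherwise adds (modulo $n$) one of the eight unit vectors $\pm e_1,\dots,\pm e_4$, each with probability $1/16$. Write $X[a,b]=\{X_t: a\le t\le b\}$ for the set of points visited between times $a$ and $b$, and let $p_{t,n}(x,y)=P(X_t=y\mid X_0=x)$. The uniform mixing time is $$\tau_n=\min\Big\{t:\ \sup_{x\in\mathbb{Z}_n^4}\Big|p_{t,n}(0,x)-\frac1{n^4}\Big|\le\frac1{2n^4}\Big\}.$$ For $U,V\subseteq\mathbb{Z}_n^4$ and $M\in\mathbb{N}$, let $$\mathrm{Close}_M(U,V)=P\big(Z_t\in U \text{ and } Z_s\in V\text{ for some } s,t\le M\big),$$ where $(Z_t)_{t\ge0}$ is a random walk on $\mathbb{Z}_n^4$ whose starting point $Z_0$ is uniformly distributed. **Proposition.** For every constant $C'>0$ there is a constant $C>0$, depending only on $C'$, such that the following holds for every $n\ge2$. Let $X=(X_t)_{t\ge0}$ and $Y=(Y_t)_{t\ge0}$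 be independent random walks on $\mathbb{Z}_n^4$, and assume that $Y_0$ is uniformly distributed on $\mathbb{Z}_n^4$. Let $K,L,M,u\in\mathbb{N}$ satisfy $K\ge C'n\log n$, $L\ge C'n\log n$, $M\ge C'n\log n$ and $u\ge\tau_n$, and put $U=X[0,K]$, $V=Y[0,L]$ and $W=X[K+u,K+L+u]$. Then $$E[\mathrm{Close}_M(U,V)]\le\frac{C\,KLM^2}{n^8(\log n)^2}\qquad\text{and}\qquad E[\mathrm{Close}_M(U,W)]\le\frac{C\,KLM^2}{n^8(\log n)^2}.$$ -/

import Mathlib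

open MeasureTheory ProbabilityTheory
open scoped ENNReal

noncomputable section

namespace TorusWalk

/-- The four-dimensional discrete torus `(ℤ/nℤ)⁴`. -/
abbrev Torus (n : ℕ) : Type := Fin 4 → ZMod n

/-- The image in the torus of the `i`-th standard basis vector of `ℤ⁴`. -/
def basisVec (n : ℕ) (i : Fin 4) : Torus n := Pi.single i 1

/-- One step of the lazy walk from `x`: stay with probability `1/2`, and move by each of the
eight unit vectors `± eᵢ` of `ℤ⁴`, reduced modulo `n`, with probability `1/16`. -/
def stepLaw (n : ℕ) (x : Torus n) : Measure (Torus n) :=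
  (1 / 2 : ℝ≥0∞) • Measure.dirac x +
    ∑ i : Fin 4, ((1 / 16 : ℝ≥0∞) • Measure.dirac (x + basisVec n i) +
      (1 / 16 : ℝ≥0∞) • Measure.dirac (x - basisVec n i))

/-- The transition kernel of the lazy walk on the torus. -/
def stepKernel (n : ℕ) [NeZero n] : Kernel (Torus n) (Torus n) :=
  Kernel.ofFunOfCountable (stepLaw n)

instance stepKernel_isMarkovKernel (n : ℕ) [NeZero n] : IsMarkovKernel (stepKernel n) := by
  refine ⟨fun x => ⟨?_⟩⟩
  change stepLaw n x Set.univ = 1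
  simp only [stepLaw, Measure.coe_add, Measure.coe_smul, Pi.add_apply, Pi.smul_apply,
    measure_univ, smul_eq_mul, mul_one, Measure.finsetSum_apply, Finset.sum_const,
    Finset.card_univ, Fintype.card_fin, nsmul_eq_mul]
  have h2 : (1 / 2 : ℝ≥0∞) = ENNReal.ofReal (1 / 2) := by
    rw [ENNReal.ofReal_div_of_pos (by norm_num)]; simp
  have h16 : (1 / 16 : ℝ≥0∞) = ENNReal.ofReal (1 / 16) := by
    rw [ENNReal.ofReal_div_of_pos (by norm_num)]; simp
  have h4 : ((4 : ℕ) : ℝ≥0∞) = ENNReal.ofReal 4 := by simp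
  rw [h2, h16, h4, ← ENNReal.ofReal_add (by norm_num) (by norm_num),
    ← ENNReal.ofReal_mul (by norm_num), ← ENNReal.ofReal_add (by norm_num) (by norm_num)]
  norm_num

/-- `X` is a random walk on the torus (with any initial distribution): a Markov chain whose
transition kernel is `stepKernel n`, so that
`P(X₀ = x₀, …, Xₜ₊₁ = xₜ₊₁) = P(X₀ = x₀, …, Xₜ = xₜ) p(xₜ, xₜ₊₁)`. -/
structure IsWalk {Ω : Type*} [MeasurableSpace Ω] (n : ℕ) [NeZero n]
    (X : ℕ → Ω → Torus n) (μ : Measure Ω) : Prop where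
  measurable : ∀ t, Measurable (X t)
  markov : ∀ (t : ℕ) (x : ℕ → Torus n),
    μ {ω | ∀ i ≤ t + 1, X i ω = x i} =
      μ {ω | ∀ i ≤ t, X i ω = x i} * stepKernel n (x t) {x (t + 1)}

/-- The set of points visited by `X` during the times `a, a + 1, …, b`. -/
def segment {Ω : Type*} {n : ℕ} (X : ℕ → Ω → Torus n) (a b : ℕ) (ω : Ω) : Set (Torus n) :=
  {x | ∃ t, a ≤ t ∧ t ≤ b ∧ X t ω = x}

/-- `p_{t,n}(x, y)`, the `t`-step transition probability from `x` to `y`. -/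
def transProb (n : ℕ) [NeZero n] (t : ℕ) (x y : Torus n) : ℝ :=
  ((stepKernel n ^ t) x {y}).toReal

/-- The uniform mixing time
`τₙ = min {t : sup_x |p_{t,n}(0, x) - n⁻⁴| ≤ n⁻⁴ / 2}`, with the convention `min ∅ = ∞`. -/
def mixingTime (n : ℕ) [NeZero n] : ℕ∞ :=
  ⨅ (t : ℕ) (_ : ∀ x : Torus n,
    |transProb n t 0 x - 1 / (n : ℝ) ^ 4| ≤ 1 / (2 * (n : ℝ) ^ 4)), (t : ℕ∞)

/-- The law, on the space of infinite trajectories, of the random walk on the torus whose starting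
point is uniformly distributed. -/
def uniformWalkLaw (n : ℕ) [NeZero n] : Measure (ℕ → Torus n) :=
  Kernel.trajMeasure (X := fun _ => Torus n) (uniformOn Set.univ)
    (fun t => (stepKernel n).comap (fun h => h ⟨t, Finset.mem_Iic.2 le_rfl⟩)
      (measurable_pi_apply _))

/-- The closeness `Close_M(U, V)`: the probability that a random walk `Z` with uniformly
distributed starting point satisfies `Z_t ∈ U` and `Z_s ∈ V` for some `s, t ≤ M`. -/
def closeness (n : ℕ) [NeZero n] (M : ℕ) (U V : Set (Torus n)) : ℝ≥0∞ :=
  uniformWalkLaw n {z | ∃ s t, s ≤ M ∧ t ≤ M ∧ z t ∈ U ∧ z s ∈ V}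

end TorusWalk

end

/-! Exchange the roles of the walks: fix the steps of `Z`, let `A` be its range, and ask for the
probability that both random sets meet `A`. When `X` and `Y` are independent this is a product of
two hitting probabilities. For the second claim, the gap of `u ≥ τₙ` steps makes the later piece of
`X` start from a law at most 3/2 times uniform, so the product bound holds up to that factor.
Averaging over the uniform `Z₀` then replaces the unknown law of `X₀` by the uniform one. Both
claims thus reduce to bounding the mean of `meanHit K A * meanHit L A`, where `meanHit T A` is the
chance that a uniformly started walk hits `A` within `T` steps (`lintegral_closeness_le_of_hitProb`,
`exists_listMean_meanHit_bound`).

The core is a first moment estimate (`listMean_meanHit_block_le`): two ranges of length `b`, one of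
them uniformly placed, meet with probability of order at most `b² / (n⁴ log b)`. Hitting a point of
the range entails, on average, order `log b` further coincidences with the range, while the total
expected number of coincidences is of order `b² / n⁴`. The logarithm comes from summing the Green
function, at least `c / (1 + |x|²)` in dimension four, along the range: since `|Yₖ|²` is about `k /
2`, the sum is harmonic. This fails at a point with probability at most the inverse of that harmonic
sum. Such bad points are handled by a union bound, at a cost of the same order as the main term.

For the second moment, cut `Z` into blocks of length `b` of order `√n`. Since `meanHit` is
subadditive and translation invariant, distinct blocks contribute independently and only first
moments are needed. The diagonal terms are bounded by cardinality, which suffices because `b log² n`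
is at most a constant times `M`. All probabilities of walks are written as averages over finite
lists of equally likely steps. -/

namespace TorusWalk

/-! ### Averages over lists of independent uniform steps. -/

section ListMean

variable {S : Type*} [Fintype S]

/-- The average of `F` over all lists of length `T` with entries in `S`. -/
noncomputable def listMean : ℕ → (List S → ℝ) → ℝ
  | 0, F => F []
  | T + 1, F => (∑ s, listMean T (fun l => F (s :: l))) / Fintype.card S

theorem listMean_mono {T : ℕ} {F F' : List S → ℝ} (h : ∀ l, l.length = T → F l ≤ F' l) :
    listMean T F ≤ listMean T F' := by
  induction T generalizing F F' with
  | zero => exact h [] rfl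
  | succ T ih =>
    simp only [listMean]
    gcongr with s _
    exact ih fun l hl => h _ (by simp [hl])

theorem listMean_congr {T : ℕ} {F F' : List S → ℝ} (h : ∀ l, l.length = T → F l = F' l) :
    listMean T F = listMean T F' :=
  le_antisymm (listMean_mono fun l hl => (h l hl).le) (listMean_mono fun l hl => (h l hl).ge)

theorem listMean_add (T : ℕ) (F F' : List S → ℝ) :
    listMean T (fun l => F l + F' l) = listMean T F + listMean T F' := by
  induction T generalizing F F' with
  | zero => rfl
  | succ T ih => simp only [listMean, ih, Finset.sum_add_distrib, add_div]

theorem listMean_const_mul (T : ℕ) (c : ℝ) (F : List S → ℝ) :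
    listMean T (fun l => c * F l) = c * listMean T F := by
  induction T generalizing F with
  | zero => rfl
  | succ T ih => simp only [listMean, ih, ← Finset.mul_sum, mul_div_assoc]

theorem listMean_mul_const (T : ℕ) (c : ℝ) (F : List S → ℝ) :
    listMean T (fun l => F l * c) = listMean T F * c := by
  simpa only [mul_comm] using listMean_const_mul T c F

theorem listMean_div_const (T : ℕ) (c : ℝ) (F : List S → ℝ) :
    listMean T (fun l => F l / c) = listMean T F / c := by
  simp only [div_eq_mul_inv, listMean_mul_const]

theorem listMean_zero (T : ℕ) : listMean T (fun _ : List S => (0 : ℝ)) = 0 := by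
  simpa using listMean_const_mul T (0 : ℝ) (fun _ : List S => (0 : ℝ))

theorem listMean_nonneg {T : ℕ} {F : List S → ℝ} (h : ∀ l, 0 ≤ F l) : 0 ≤ listMean T F := by
  rw [← listMean_zero (S := S) T]
  exact listMean_mono fun l _ => h l

theorem listMean_sum {ι : Type*} (T : ℕ) (s : Finset ι) (F : ι → List S → ℝ) :
    listMean T (fun l => ∑ i ∈ s, F i l) = ∑ i ∈ s, listMean T (F i) := by
  classical
  induction s using Finset.induction_on with
  | empty => simpa using listMean_zero T
  | insert a s ha ih => simp only [Finset.sum_insert ha, listMean_add, ih]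

theorem listMean_append (a b : ℕ) (F : List S → ℝ) :
    listMean (a + b) F = listMean a (fun l => listMean b (fun l' => F (l ++ l'))) := by
  induction a generalizing F with
  | zero => simp [listMean]
  | succ a ih => simp only [Nat.succ_add, listMean, ih, List.cons_append]

theorem listMean_succ_last (T : ℕ) (F : List S → ℝ) :
    listMean (T + 1) F = listMean T (fun l => (∑ s, F (l ++ [s])) / Fintype.card S) := by
  rw [listMean_append]
  rfl

variable [Nonempty S]

theorem listMean_const (T : ℕ) (c : ℝ) : listMean T (fun _ : List S => c) = c := by
  induction T with
  | zero => rfl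
  | succ T ih =>
    have : (Fintype.card S : ℝ) ≠ 0 := by exact_mod_cast Fintype.card_ne_zero
    simp only [listMean, ih, Finset.sum_const, Finset.card_univ, nsmul_eq_mul]
    field_simp

theorem listMean_take (a b : ℕ) (F : List S → ℝ) :
    listMean (a + b) (fun l => F (l.take a)) = listMean a F := by
  rw [listMean_append]
  refine listMean_congr fun l hl => ?_
  subst hl
  simp [listMean_const]

theorem listMean_drop (a b : ℕ) (F : List S → ℝ) :
    listMean (a + b) (fun l => F (l.drop a)) = listMean b F := by
  rw [listMean_append]
  rw [← listMean_const (S := S) a (listMean b F)]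
  refine listMean_congr fun l hl => ?_
  subst hl
  simp

end ListMean

/-! ### Indicator of intersecting sets. -/

section Meet

variable {G : Type*} [DecidableEq G]

/-- The indicator of the event that two finite sets have a common point. -/
def meet (A B : Finset G) : ℝ := if Disjoint A B then 0 else 1

theorem meet_nonneg (A B : Finset G) : 0 ≤ meet A B := by
  unfold meet; split_ifs <;> norm_num

theorem meet_eq_one {A B : Finset G} {x : G} (hA : x ∈ A) (hB : x ∈ B) : meet A B = 1 :=
  if_neg (Finset.not_disjoint_iff.2 ⟨x, hA, hB⟩)

theorem meet_mono {A A' B B' : Finset G} (hA : A ⊆ A') (hB : B ⊆ B') : meet A B ≤ meet A' B' := by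
  by_cases h : Disjoint A' B'
  · rw [meet, if_pos (h.mono hA hB)]
    exact meet_nonneg _ _
  · rw [meet, meet, if_neg h]
    split_ifs <;> norm_num

theorem meet_union_left_le (A A' B : Finset G) : meet (A ∪ A') B ≤ meet A B + meet A' B := by
  by_cases h : Disjoint A B <;> by_cases h' : Disjoint A' B <;>
    simp [meet, Finset.disjoint_union_left, h, h']

theorem meet_comm (A B : Finset G) : meet A B = meet B A := by
  simp [meet, disjoint_comm]

theorem meet_union_right_le (A B B' : Finset G) : meet A (B ∪ B') ≤ meet A B + meet A B' := by
  simpa only [meet_comm A] using meet_union_left_le B B' A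

end Meet

/-! ### Ranges of walks and hitting probabilities. -/

section Visited

variable {S G : Type*} [AddCommGroup G] (v : S → G)

/-- The displacement after the first `k` of the steps listed in `l`. -/
def walkPos (l : List S) (k : ℕ) : G := ((l.take k).map v).sum

@[simp] theorem walkPos_zero (l : List S) : walkPos v l 0 = 0 := by simp [walkPos]

theorem walkPos_length (l : List S) : walkPos v l l.length = (l.map v).sum := by simp [walkPos]

theorem walkPos_append_left {l : List S} (l' : List S) {k : ℕ} (hk : k ≤ l.length) :
    walkPos v (l ++ l') k = walkPos v l k := by
  simp [walkPos, List.take_append_of_le_length hk]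

theorem walkPos_append_right (l l' : List S) (k : ℕ) :
    walkPos v (l ++ l') (l.length + k) = (l.map v).sum + walkPos v l' k := by
  simp [walkPos, List.take_append, List.take_of_length_le]

theorem walkPos_drop (l : List S) (j k : ℕ) :
    walkPos v (l.drop j) k = walkPos v l (j + k) - walkPos v l j := by
  simp [walkPos, List.take_add]

theorem walkPos_take (l : List S) {j k : ℕ} (h : k ≤ j) :
    walkPos v (l.take j) k = walkPos v l k := by
  simp [walkPos, List.take_take, h]

theorem map_walkPos {H : Type*} [AddCommGroup H] (f : G →+ H) (l : List S) (k : ℕ) :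
    f (walkPos v l k) = walkPos (fun s => f (v s)) l k := by
  simp [walkPos, map_list_sum, Function.comp_def]

variable [DecidableEq G]

/-- The set of points visited by the walk from `x` with the steps listed in `l`. -/
def visited (x : G) (l : List S) : Finset G :=
  (Finset.range (l.length + 1)).image fun k => x + walkPos v l k

theorem mem_visited {x y : G} {l : List S} :
    y ∈ visited v x l ↔ ∃ k ≤ l.length, x + walkPos v l k = y := by
  simp [visited]

theorem card_visited_le (x : G) (l : List S) : (visited v x l).card ≤ l.length + 1 :=
  Finset.card_image_le.trans_eq (Finset.card_range _)

theorem visited_append (x : G) (l l' : List S) :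
    visited v x (l ++ l') = visited v x l ∪ visited v (x + (l.map v).sum) l' := by
  ext y
  simp only [Finset.mem_union, mem_visited, List.length_append]
  constructor
  · rintro ⟨k, hk, rfl⟩
    rcases le_or_gt k l.length with h | h
    · exact Or.inl ⟨k, h, by rw [walkPos_append_left v l' h]⟩
    · obtain ⟨j, rfl⟩ := Nat.exists_eq_add_of_le h.le
      exact Or.inr ⟨j, by omega, by rw [walkPos_append_right, add_assoc]⟩
  · rintro (⟨k, hk, rfl⟩ | ⟨k, hk, rfl⟩)
    · exact ⟨k, by omega, by rw [walkPos_append_left v l' hk]⟩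
    · exact ⟨l.length + k, by omega, by rw [walkPos_append_right, add_assoc]⟩

theorem mem_visited_add {x y a : G} {l : List S} :
    y ∈ visited v (x + a) l ↔ y - a ∈ visited v x l := by
  simp only [mem_visited]
  refine exists_congr fun k => and_congr_right fun _ => ?_
  constructor
  · rintro rfl; abel
  · intro h; rw [← sub_eq_zero] at h ⊢; rw [← h]; abel

theorem visited_cons (x : G) (s : S) (l : List S) :
    visited v x (s :: l) = insert x (visited v (x + v s) l) := by
  have : visited v x [s] = {x, x + v s} := by
    ext y; simp [visited, Finset.range_add_one, walkPos, eq_comm, or_comm]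
  have h := visited_append v x [s] l
  rw [this] at h
  simp only [List.singleton_append, List.map_cons, List.map_nil, List.sum_cons, List.sum_nil,
    add_zero] at h
  rw [h]
  ext y
  simp only [Finset.mem_union, Finset.mem_insert, Finset.mem_singleton]
  refine ⟨?_, by tauto⟩
  rintro ((rfl | rfl) | h)
  · exact Or.inl rfl
  · exact Or.inr ((mem_visited v).2 ⟨0, by simp, by simp⟩)
  · exact Or.inr h

variable [Fintype S]

/-- The probability that the walk from `x` visits `A` within `T` steps. -/
noncomputable def hitProb (A : Finset G) (T : ℕ) (x : G) : ℝ :=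
  listMean T fun l => meet (visited v x l) A

theorem hitProb_zero (A : Finset G) (x : G) : hitProb v A 0 x = if x ∈ A then 1 else 0 := by
  simp [hitProb, listMean, visited, meet]

theorem hitProb_nonneg (A : Finset G) (T : ℕ) (x : G) : 0 ≤ hitProb v A T x :=
  listMean_nonneg fun _ => meet_nonneg _ _

theorem hitProb_mem [Nonempty S] {A : Finset G} (T : ℕ) {x : G} (hx : x ∈ A) :
    hitProb v A T x = 1 := by
  rw [hitProb, ← listMean_const (S := S) T 1]
  exact listMean_congr fun _ _ => meet_eq_one ((mem_visited v).2 ⟨0, by simp, by simp⟩) hx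

theorem hitProb_succ {A : Finset G} (T : ℕ) {x : G} (hx : x ∉ A) :
    hitProb v A (T + 1) x = (∑ s, hitProb v A T (x + v s)) / Fintype.card S := by
  simp [hitProb, listMean, visited_cons, meet, hx]

theorem hitProb_translate {A A' : Finset G} (T : ℕ) (x a : G) (h : ∀ y, y ∈ A' ↔ y - a ∈ A) :
    hitProb v A' T (x + a) = hitProb v A T x := by
  refine listMean_congr fun l _ => ?_
  unfold meet
  congr 1
  simp only [Finset.disjoint_left, mem_visited_add, h]
  refine propext ⟨fun H y hy => ?_, fun H y hy => H hy⟩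
  have := @H (y + a)
  simpa using this (by simpa using hy)

variable [Fintype G]

/-- The probability that the walk with uniform starting point visits `A` within `T` steps. -/
noncomputable def meanHit (T : ℕ) (A : Finset G) : ℝ :=
  (∑ x, hitProb v A T x) / Fintype.card G

theorem meanHit_nonneg (T : ℕ) (A : Finset G) : 0 ≤ meanHit v T A :=
  div_nonneg (Finset.sum_nonneg fun _ _ => hitProb_nonneg ..) (Nat.cast_nonneg _)

theorem meanHit_translate {A A' : Finset G} (T : ℕ) (a : G) (h : ∀ y, y ∈ A' ↔ y - a ∈ A) :
    meanHit v T A' = meanHit v T A := by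
  rw [meanHit, meanHit, ← Equiv.sum_comp (Equiv.addRight a)]
  congr 1
  exact Finset.sum_congr rfl fun x _ => hitProb_translate v T x a h

theorem meanHit_visited (T : ℕ) (x : G) (l : List S) :
    meanHit v T (visited v x l) = meanHit v T (visited v 0 l) :=
  meanHit_translate v T x fun y => by rw [← mem_visited_add, zero_add]

theorem meanHit_mono (T : ℕ) {A B : Finset G} (h : A ⊆ B) : meanHit v T A ≤ meanHit v T B := by
  unfold meanHit hitProb
  gcongr
  exact listMean_mono fun l _ => meet_mono le_rfl h

theorem meanHit_union_le (T : ℕ) (A B : Finset G) :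
    meanHit v T (A ∪ B) ≤ meanHit v T A + meanHit v T B := by
  unfold meanHit hitProb
  rw [← add_div, ← Finset.sum_add_distrib]
  gcongr
  rw [← listMean_add]
  exact listMean_mono fun l _ => meet_union_right_le _ _ _

theorem meanHit_eq (T : ℕ) (A : Finset G) :
    meanHit v T A = listMean T (fun l => ∑ x, meet (visited v x l) A) /
      Fintype.card G := by
  rw [listMean_sum]
  rfl

/-- The uniform law is invariant under the walk, so after `T` steps the walk is again uniformly
placed. A union bound over the two time windows then suffices. -/
theorem meanHit_time_add_le [Nonempty S] (T T' : ℕ) (A : Finset G) :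
    meanHit v (T + T') A ≤ meanHit v T A + meanHit v T' A := by
  simp only [meanHit_eq]
  rw [← add_div]
  gcongr
  rw [listMean_append]
  calc _ ≤ listMean T (fun l => listMean T' fun l' =>
        ((∑ x, meet (visited v x l) A) +
          ∑ x, meet (visited v x l') A)) := by
        refine listMean_mono fun l _ => listMean_mono fun l' _ => ?_
        rw [← Equiv.sum_comp (Equiv.addRight (l.map v).sum)
          (fun x => meet (visited v x l') A), ← Finset.sum_add_distrib]
        refine Finset.sum_le_sum fun x _ => ?_
        rw [visited_append]
        exact meet_union_left_le _ _ _
    _ = _ := by simp only [listMean_add, listMean_const]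

theorem meanHit_mono_time [Nonempty S] {T T' : ℕ} (h : T ≤ T') (A : Finset G) :
    meanHit v T A ≤ meanHit v T' A := by
  obtain ⟨d, rfl⟩ := Nat.exists_eq_add_of_le h
  unfold meanHit
  gcongr with x
  rw [hitProb, ← listMean_take T d]
  refine listMean_mono fun l _ => ?_
  refine meet_mono ?_ le_rfl
  conv_rhs => rw [← List.take_append_drop T l, visited_append]
  exact Finset.subset_union_left

theorem meanHit_mul_le [Nonempty S] (q T : ℕ) (hq : 1 ≤ q) (A : Finset G) :
    meanHit v (q * T) A ≤ q * meanHit v T A := by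
  induction q, hq using Nat.le_induction with
  | base => simp
  | succ q _ ih =>
    rw [add_mul, one_mul]
    refine (meanHit_time_add_le v _ _ A).trans ?_
    push_cast
    linarith

/-- Union bound over the points of `A`: for fixed steps, the starting points from which a given
point is visited are as many as the visited points, hence at most `T + 1`. -/
theorem meanHit_le_card [Nonempty S] (T : ℕ) (A : Finset G) :
    meanHit v T A ≤ (T + 1) * A.card / Fintype.card G := by
  rw [meanHit_eq]
  gcongr
  rw [← listMean_const (S := S) T ((T + 1) * A.card)]
  refine listMean_mono fun l hl => ?_
  calc (∑ x, meet (visited v x l) A)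
      ≤ ∑ x, ∑ a ∈ A, if a ∈ visited v x l then (1 : ℝ) else 0 := by
        refine Finset.sum_le_sum fun x _ => ?_
        unfold meet
        split_ifs with h
        · exact Finset.sum_nonneg fun a _ => by split_ifs <;> norm_num
        · obtain ⟨a, ha, haA⟩ := Finset.not_disjoint_iff.1 h
          refine le_trans ?_ (Finset.single_le_sum (f := fun a => if a ∈ visited v x l then (1 : ℝ)
            else 0) (fun a _ => by split_ifs <;> norm_num) haA)
          simp [ha]
    _ = ∑ a ∈ A, ∑ x, if a - x ∈ visited v 0 l then (1 : ℝ) else 0 := by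
        rw [Finset.sum_comm]
        simp only [← mem_visited_add, zero_add]
    _ = ∑ a ∈ A, ((visited v 0 l).card : ℝ) := by
        refine Finset.sum_congr rfl fun a _ => ?_
        have := Equiv.sum_comp (Equiv.subLeft a)
          (fun y => if y ∈ visited v 0 l then (1 : ℝ) else 0)
        simp only [Equiv.subLeft_apply] at this
        rw [this]
        simp
    _ ≤ ∑ a ∈ A, ((T : ℝ) + 1) := by
        gcongr
        have := card_visited_le v 0 l
        rw [hl] at this
        exact_mod_cast this
    _ = _ := by rw [Finset.sum_const, nsmul_eq_mul, mul_comm]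

end Visited

end TorusWalk
namespace TorusWalk

/-! ### Occupation sums, Green functions and hitting bounds. -/

section Occupation

variable {S G : Type*} [AddCommGroup G] (v : S → G) [Fintype S]

/-- The expected sum of `φ` over the first `r + 1` positions of the walk from `z`. -/
noncomputable def occupation (φ : G → ℝ) (r : ℕ) (z : G) : ℝ :=
  ∑ i ∈ Finset.range (r + 1), listMean i fun l => φ (z + (l.map v).sum)

theorem occupation_nonneg {φ : G → ℝ} (hφ : ∀ z, 0 ≤ φ z) (r : ℕ) (z : G) :
    0 ≤ occupation v φ r z :=
  Finset.sum_nonneg fun _ _ => listMean_nonneg fun _ => hφ _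

theorem occupation_mono {φ : G → ℝ} (hφ : ∀ z, 0 ≤ φ z) {r r' : ℕ} (h : r ≤ r') (z : G) :
    occupation v φ r z ≤ occupation v φ r' z :=
  Finset.sum_le_sum_of_subset_of_nonneg (Finset.range_subset_range.2 (by omega))
    fun _ _ _ => listMean_nonneg fun _ => hφ _

theorem occupation_succ (φ : G → ℝ) (r : ℕ) (z : G) :
    occupation v φ (r + 1) z =
      φ z + (∑ s, occupation v φ r (z + v s)) / Fintype.card S := by
  unfold occupation
  rw [Finset.sum_range_succ', add_comm, Finset.sum_comm, Finset.sum_div]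
  simp [listMean, add_assoc]

/-- Strong Markov property at the first entrance to `B`: at least `r` steps remain from there, and
they alone contribute at least `δ` in expectation. The induction on `t` conditions on the first
step. -/
theorem mul_hitProb_le_occupation [Nonempty S] [DecidableEq G] {φ : G → ℝ} (hφ : ∀ z, 0 ≤ φ z)
    {B : Finset G} {r : ℕ} {δ : ℝ} (hB : ∀ z ∈ B, δ ≤ occupation v φ r z) (t : ℕ) (z : G) :
    δ * hitProb v B t z ≤ occupation v φ (t + r) z := by
  induction t generalizing z with
  | zero =>
    rw [hitProb_zero]
    split_ifs with h
    · simpa using hB z h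
    · simpa using occupation_nonneg v hφ _ z
  | succ t ih =>
    by_cases h : z ∈ B
    · rw [hitProb_mem v _ h, mul_one]
      exact (hB z h).trans (occupation_mono v hφ (by omega) z)
    · rw [hitProb_succ v _ h, Nat.succ_add, occupation_succ, ← mul_div_assoc, Finset.mul_sum]
      refine le_trans ?_ (le_add_of_nonneg_left (hφ z))
      gcongr
      exact ih _

variable [DecidableEq G]

/-- The expected number of visits to `x` during the first `r` steps of the walk from `0`. -/
noncomputable def green (r : ℕ) (x : G) : ℝ :=
  ∑ i ∈ Finset.range (r + 1), listMean i fun l => if (l.map v).sum = x then 1 else 0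

theorem green_nonneg (r : ℕ) (x : G) : 0 ≤ green v r x :=
  Finset.sum_nonneg fun _ _ => listMean_nonneg fun _ => by split_ifs <;> norm_num

/-- A visit to `x` projects to a visit to `f x`, so lower bounds for the Green function on `ℤ⁴` pass
to the torus. -/
theorem green_le_green_map {H : Type*} [AddCommGroup H] [DecidableEq H] (f : G →+ H) (r : ℕ)
    (x : G) : green v r x ≤ green (fun s => f (v s)) r (f x) := by
  refine Finset.sum_le_sum fun i _ => listMean_mono fun l _ => ?_
  have : (l.map fun s => f (v s)).sum = f (l.map v).sum := by
    simp [map_list_sum, Function.comp_def]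
  rw [this]
  split_ifs with h1 h2 h2 <;> first | exact absurd (congrArg f h1) h2 | norm_num

theorem occupation_count (y : ℕ → G) (m r : ℕ) (z : G) :
    occupation v (fun x => ∑ k ∈ Finset.range m, if x = y k then (1 : ℝ) else 0) r z =
      ∑ k ∈ Finset.range m, green v r (y k - z) := by
  unfold occupation green
  rw [Finset.sum_comm]
  refine Finset.sum_congr rfl fun i _ => ?_
  rw [← listMean_sum]
  simp only [eq_sub_iff_add_eq']

/-- Apply the entrance inequality with `φ` counting the indices `k` such that `y k` is the current
position, then sum over the starting point: each `y k` receives a total expected mass of exactly `T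
+ r + 1`. -/
theorem mul_meanHit_le [Nonempty S] [Fintype G] (y : ℕ → G) (m r T : ℕ) {δ : ℝ} {B : Finset G}
    (hB : ∀ z ∈ B, δ ≤ ∑ k ∈ Finset.range m, green v r (y k - z)) :
    δ * meanHit v T B ≤ (T + r + 1) * m / Fintype.card G := by
  have key : ∀ z, δ * hitProb v B T z ≤ ∑ k ∈ Finset.range m, green v (T + r) (y k - z) := by
    intro z
    rw [← occupation_count]
    refine mul_hitProb_le_occupation v (fun x => ?_) (fun z hz => ?_) T z
    · exact Finset.sum_nonneg fun k _ => by split_ifs <;> norm_num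
    · rw [occupation_count]
      exact hB z hz
  rw [meanHit, ← mul_div_assoc, Finset.mul_sum]
  gcongr
  refine (Finset.sum_le_sum fun z _ => key z).trans (le_of_eq ?_)
  have total : ∀ k, ∑ z, green v (T + r) (y k - z) = T + r + 1 := by
    intro k
    have := Equiv.sum_comp (Equiv.subLeft (y k)) (green v (T + r))
    simp only [Equiv.subLeft_apply] at this
    rw [this]
    unfold green
    rw [Finset.sum_comm]
    simp only [← listMean_sum, Finset.sum_ite_eq, Finset.mem_univ, if_true, listMean_const]
    simp
  rw [Finset.sum_comm]
  simp only [total, Finset.sum_const, Finset.card_range, nsmul_eq_mul]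
  ring

end Occupation

end TorusWalk
namespace TorusWalk

/-! ### Second moments of the squared norm, and typical walks. -/

section Martingale

/-- The sixteen equally likely steps of the lazy walk: a coordinate together with an instruction
which says `stay` twice, `+1` once and `-1` once. -/
abbrev Step : Type := Fin 4 × Fin 4

/-- The displacement along the chosen coordinate. -/
def stepSign : Fin 4 → ℤ := ![0, 0, 1, -1]

/-- The displacement in `ℤ⁴` of a step. -/
def stepVec (s : Step) : Fin 4 → ℤ := Pi.single s.1 (stepSign s.2)

/-- The square of the Euclidean norm. -/
def normSq (x : Fin 4 → ℤ) : ℝ := ∑ i, (x i : ℝ) ^ 2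

theorem normSq_nonneg (x : Fin 4 → ℤ) : 0 ≤ normSq x := Finset.sum_nonneg fun _ _ => sq_nonneg _

theorem normSq_add_stepVec (x : Fin 4 → ℤ) (s : Step) :
    normSq (x + stepVec s) = normSq x + 2 * x s.1 * stepSign s.2 + (stepSign s.2 : ℝ) ^ 2 := by
  obtain ⟨i, r⟩ := s
  have : ∀ j, ((x + stepVec (i, r)) j : ℝ) ^ 2 =
      (x j : ℝ) ^ 2 + if j = i then 2 * (x i : ℝ) * stepSign r + (stepSign r : ℝ) ^ 2 else 0 := by
    intro j
    by_cases h : j = i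
    · subst h; simp [stepVec]; ring
    · simp [stepVec, h]
  simp only [normSq, this, Finset.sum_add_distrib, Finset.sum_ite_eq', Finset.mem_univ, if_true]
  ring

theorem normSq_increment (x : Fin 4 → ℤ) (s : Step) :
    normSq (x + stepVec s) - normSq x - 1 / 2 =
      2 * x s.1 * stepSign s.2 + (stepSign s.2 : ℝ) ^ 2 - 1 / 2 := by
  rw [normSq_add_stepVec]; ring

theorem sum_normSq_increment (x : Fin 4 → ℤ) :
    ∑ s : Step, (normSq (x + stepVec s) - normSq x - 1 / 2) = 0 := by
  simp only [normSq_increment, Fintype.sum_prod_type, Fin.sum_univ_four]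
  simp [stepSign]
  ring

theorem sum_normSq_increment_sq (x : Fin 4 → ℤ) :
    ∑ s : Step, (normSq (x + stepVec s) - normSq x - 1 / 2) ^ 2 = 8 * normSq x + 4 := by
  simp only [normSq_increment]
  simp only [Fintype.sum_prod_type, Fin.sum_univ_four, normSq]
  simp [stepSign]
  ring

/-- The martingale `|Yₖ|² - k / 2`. -/
noncomputable def normMart (l : List Step) (k : ℕ) : ℝ := normSq (walkPos stepVec l k) - k / 2

/-- The weighted sum `∑ (|Yₖ|² - k / 2) / k²` over `1 ≤ k ≤ T`. -/
noncomputable def normMartSum (T : ℕ) (l : List Step) : ℝ :=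
  ∑ k ∈ Finset.range T, normMart l (k + 1) / ((k : ℝ) + 1) ^ 2

theorem normMart_append {l l' : List Step} {k : ℕ} (hk : k ≤ l.length) :
    normMart (l ++ l') k = normMart l k := by
  rw [normMart, normMart, walkPos_append_left _ _ hk]

theorem normMartSum_append {l l' : List Step} {T : ℕ} (hk : T ≤ l.length) :
    normMartSum T (l ++ l') = normMartSum T l :=
  Finset.sum_congr rfl fun k hk' => by
    rw [normMart_append]
    have := Finset.mem_range.1 hk'
    omega

/-- The increment of `normMart`. -/
theorem normMart_snoc {l : List Step} {T : ℕ} (hl : l.length = T) (s : Step) :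
    normMart (l ++ [s]) (T + 1) = normMart l T +
      (normSq (walkPos stepVec l T + stepVec s) - normSq (walkPos stepVec l T) - 1 / 2) := by
  subst hl
  simp only [normMart]
  rw [walkPos_append_right, ← walkPos_length]
  simp [walkPos]
  ring

/-- Martingale property: the increment has mean zero given the first `T` steps, which determine `F`.
-/
theorem listMean_mul_normMart_succ (T : ℕ) (F : List Step → ℝ)
    (hF : ∀ l s, l.length = T → F (l ++ [s]) = F l) :
    listMean (T + 1) (fun l => F l * normMart l (T + 1)) =
      listMean T (fun l => F l * normMart l T) := by
  rw [listMean_succ_last]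
  refine listMean_congr fun l hl => ?_
  simp only [hF l _ hl, normMart_snoc hl]
  rw [← Finset.mul_sum, Finset.sum_add_distrib, sum_normSq_increment]
  simp
  ring

theorem listMean_normMart (T : ℕ) : listMean T (fun l => normMart l T) = 0 := by
  induction T with
  | zero => simp [listMean, normMart, normSq]
  | succ T ih =>
    have := listMean_mul_normMart_succ T (fun _ => 1) (fun _ _ _ => rfl)
    simpa [ih] using this

theorem listMean_normSq (T : ℕ) :
    listMean T (fun l => normSq (walkPos stepVec l T)) = T / 2 := by
  have h := listMean_normMart T
  simp only [normMart, sub_eq_add_neg, listMean_add, listMean_const] at h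
  linarith

theorem listMean_normMart_sq (T : ℕ) :
    listMean T (fun l => normMart l T ^ 2) = T * (T + 1) / 8 := by
  induction T with
  | zero => simp [listMean, normMart, normSq]
  | succ T ih =>
    rw [listMean_succ_last]
    have : listMean T (fun l => (∑ s, normMart (l ++ [s]) (T + 1) ^ 2) / Fintype.card Step) =
        listMean T (fun l => normMart l T ^ 2 + (normSq (walkPos stepVec l T) * (1 / 2) + 1 / 4)) := by
      refine listMean_congr fun l hl => ?_
      simp only [normMart_snoc hl, add_sq, Finset.sum_add_distrib, ← Finset.mul_sum,
        sum_normSq_increment, sum_normSq_increment_sq]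
      simp
      ring
    rw [this, listMean_add, listMean_add, listMean_mul_const, ih, listMean_normSq, listMean_const]
    push_cast
    ring

theorem normMartSum_succ (T : ℕ) (l : List Step) :
    normMartSum (T + 1) l = normMartSum T l + normMart l (T + 1) / ((T : ℝ) + 1) ^ 2 := by
  rw [normMartSum, Finset.sum_range_succ, normMartSum]

theorem listMean_normMartSum_mul_succ (T : ℕ) :
    listMean (T + 1) (fun l => normMartSum T l * normMart l (T + 1)) =
      listMean T (fun l => normMartSum T l * normMart l T) :=
  listMean_mul_normMart_succ T _ fun _ _ hl => normMartSum_append hl.ge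

theorem listMean_normMartSum_mul_le (T : ℕ) :
    listMean T (fun l => normMartSum T l * normMart l T) ≤ T / 4 := by
  induction T with
  | zero => simp [listMean, normMartSum]
  | succ T ih =>
    have : ∀ l, normMartSum (T + 1) l * normMart l (T + 1) =
        normMartSum T l * normMart l (T + 1) + 1 / ((T : ℝ) + 1) ^ 2 * normMart l (T + 1) ^ 2 := by
      intro l; rw [normMartSum_succ]; ring
    simp only [this]
    rw [listMean_add, listMean_const_mul, listMean_normMartSum_mul_succ, listMean_normMart_sq]
    have h2 : 1 / ((T : ℝ) + 1) ^ 2 * (((T + 1 : ℕ) : ℝ) * ((T + 1 : ℕ) + 1) / 8) ≤ 1 / 4 := by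
      push_cast
      rw [div_mul_eq_mul_div, div_le_div_iff₀ (by positivity) (by norm_num)]
      nlinarith [(Nat.cast_nonneg T : (0 : ℝ) ≤ T)]
    push_cast at *
    linarith

/-- Expand the square at each new term. The cross term is controlled by
`listMean_normMartSum_mul_le` and the new square by the exact second moment; together they add at
most `1 / (T + 1)`. -/
theorem listMean_normMartSum_sq_le (T : ℕ) :
    listMean T (fun l => normMartSum T l ^ 2) ≤ ∑ k ∈ Finset.range T, 1 / ((k : ℝ) + 1) := by
  induction T with
  | zero => simp [listMean, normMartSum]
  | succ T ih =>
    have : ∀ l, normMartSum (T + 1) l ^ 2 = normMartSum T l ^ 2 +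
        (2 / ((T : ℝ) + 1) ^ 2 * (normMartSum T l * normMart l (T + 1)) +
          1 / ((T : ℝ) + 1) ^ 4 * normMart l (T + 1) ^ 2) := by
      intro l; rw [normMartSum_succ]; field_simp; ring
    simp only [this]
    rw [listMean_add, listMean_add, listMean_const_mul, listMean_const_mul,
      listMean_normMartSum_mul_succ, listMean_normMart_sq, Finset.sum_range_succ]
    have h1 : listMean (T + 1) (fun l => normMartSum T l ^ 2) =
        listMean T (fun l => normMartSum T l ^ 2) := by
      rw [listMean_append]
      exact listMean_congr fun l hl => by simp [normMartSum_append hl.ge, listMean_const]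
    rw [h1]
    have h2 : 2 / ((T : ℝ) + 1) ^ 2 * listMean T (fun l => normMartSum T l * normMart l T) ≤
        2 / ((T : ℝ) + 1) ^ 2 * (T / 4) := by
      gcongr; exact listMean_normMartSum_mul_le T
    have h3 : 2 / ((T : ℝ) + 1) ^ 2 * (T / 4) +
        1 / ((T : ℝ) + 1) ^ 4 * (((T + 1 : ℕ) : ℝ) * ((T + 1 : ℕ) + 1) / 8) ≤ 1 / ((T : ℝ) + 1) := by
      have hT := (Nat.cast_nonneg T : (0 : ℝ) ≤ T)
      have : 1 / ((T : ℝ) + 1) - (2 / ((T : ℝ) + 1) ^ 2 * (T / 4) +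
        1 / ((T : ℝ) + 1) ^ 4 * (((T + 1 : ℕ) : ℝ) * ((T + 1 : ℕ) + 1) / 8)) =
        (4 * (T : ℝ) ^ 2 + 11 * T + 6) / (8 * ((T : ℝ) + 1) ^ 3) := by
        push_cast; field_simp; ring
      rw [← sub_nonneg, this]
      positivity
    linarith

/-- The harmonic number `∑ 1 / k` over `1 ≤ k ≤ T`. -/
noncomputable def harmonicSum (T : ℕ) : ℝ := ∑ k ∈ Finset.range T, 1 / ((k : ℝ) + 1)

theorem harmonicSum_pos {T : ℕ} (hT : 1 ≤ T) : 0 < harmonicSum T :=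
  Finset.sum_pos (fun _ _ => by positivity) (Finset.nonempty_range_iff.2 (by omega))

open Classical in
-- Chebyshev's inequality, with variance bound equal to the threshold itself. The exceptional
-- probability is of order `1 / log T`, just small enough for the bad points to cost no more than
-- the good ones.
theorem listMean_normMartSum_gt_le {T : ℕ} (hT : 1 ≤ T) :
    listMean T (fun l => if harmonicSum T < normMartSum T l then 1 else 0) ≤
      1 / harmonicSum T := by
  have hH := harmonicSum_pos hT
  calc _ ≤ listMean T (fun l => 1 / harmonicSum T ^ 2 * normMartSum T l ^ 2) := by
        refine listMean_mono fun l _ => ?_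
        split_ifs with h
        · rw [one_div_mul_eq_div, one_le_div (by positivity)]
          gcongr
        · positivity
    _ ≤ 1 / harmonicSum T ^ 2 * harmonicSum T := by
        rw [listMean_const_mul]
        gcongr
        exact listMean_normMartSum_sq_le T
    _ = _ := by field_simp

/-- Cauchy–Schwarz turns an upper bound on the norms into a lower bound on the reciprocals: `1 / k`
is the geometric mean of `1 / (1 + |Yₖ|²)` and `(1 + |Yₖ|²) / k²`. The sum of the latter is at most
3/2 of the harmonic sum plus `normMartSum`, hence the factor 5/2. -/
theorem sum_inv_one_add_normSq_ge {T : ℕ} (hT : 1 ≤ T) {l : List Step}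
    (h : normMartSum T l ≤ harmonicSum T) :
    2 / 5 * harmonicSum T ≤
      ∑ k ∈ Finset.range T, 1 / (1 + normSq (walkPos stepVec l (k + 1))) := by
  have hH := harmonicSum_pos hT
  set a : ℕ → ℝ := fun k => 1 / (1 + normSq (walkPos stepVec l (k + 1)))
  set b : ℕ → ℝ := fun k => (1 + normSq (walkPos stepVec l (k + 1))) / ((k : ℝ) + 1) ^ 2
  have hpos : ∀ k, 0 < 1 + normSq (walkPos stepVec l (k + 1)) := fun k => by
    have := normSq_nonneg (walkPos stepVec l (k + 1)); linarith
  have cs : harmonicSum T ^ 2 ≤ (∑ k ∈ Finset.range T, a k) * ∑ k ∈ Finset.range T, b k := by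
    refine Finset.sum_sq_le_sum_mul_sum_of_sq_le_mul _ (fun k _ => ?_) (fun k _ => ?_)
      (fun k _ => ?_)
    · exact (one_div_pos.2 (hpos k)).le
    · exact div_nonneg (hpos k).le (sq_nonneg _)
    · have := (hpos k).ne'
      refine le_of_eq ?_
      simp only [a, b]
      field_simp
  have hb : ∑ k ∈ Finset.range T, b k ≤ 5 / 2 * harmonicSum T := by
    have : ∑ k ∈ Finset.range T, b k ≤ 3 / 2 * harmonicSum T + normMartSum T l := by
      rw [harmonicSum, normMartSum, Finset.mul_sum, ← Finset.sum_add_distrib]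
      refine Finset.sum_le_sum fun k _ => ?_
      have : 3 / 2 * (1 / ((k : ℝ) + 1)) + normMart l (k + 1) / ((k : ℝ) + 1) ^ 2 - b k =
          k / ((k : ℝ) + 1) ^ 2 := by
        simp only [b, normMart]; push_cast; field_simp; ring
      rw [← sub_nonneg, this]
      positivity
    linarith
  have ha : 0 ≤ ∑ k ∈ Finset.range T, a k :=
    Finset.sum_nonneg fun k _ => (one_div_pos.2 (hpos k)).le
  have := cs.trans (mul_le_mul_of_nonneg_left hb ha)
  have h2 : harmonicSum T ≤ (∑ k ∈ Finset.range T, a k) * (5 / 2) :=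
    le_of_mul_le_mul_right (by nlinarith) hH
  linarith

end Martingale

end TorusWalk
namespace TorusWalk

/-! ### Lower bounds for binomial probabilities near the centre. -/

section Binomial

/-- The probability that `m` fair coins show `j` heads. -/
noncomputable def coinProb : ℕ → ℤ → ℝ
  | 0, j => if j = 0 then 1 else 0
  | m + 1, j => (coinProb m j + coinProb m (j - 1)) / 2

theorem coinProb_nonneg (m : ℕ) (j : ℤ) : 0 ≤ coinProb m j := by
  induction m generalizing j with
  | zero => simp only [coinProb]; split_ifs <;> norm_num
  | succ m ih => simp only [coinProb]; linarith [ih j, ih (j - 1)]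

theorem coinProb_of_neg (m : ℕ) {j : ℤ} (hj : j < 0) : coinProb m j = 0 := by
  induction m generalizing j with
  | zero => simp [coinProb, hj.ne]
  | succ m ih => simp [coinProb, ih hj, ih (show j - 1 < 0 by omega)]

theorem coinProb_natCast (m k : ℕ) : coinProb m k = m.choose k / 2 ^ m := by
  induction m generalizing k with
  | zero => cases k <;> simp [coinProb]; omega
  | succ m ih =>
    cases k with
    | zero =>
      have := ih 0
      simp only [Nat.cast_zero] at this
      simp [coinProb, this, coinProb_of_neg, pow_succ, div_eq_mul_inv, mul_comm]
    | succ k =>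
      have : ((k + 1 : ℕ) : ℤ) - 1 = k := by push_cast; ring
      simp only [coinProb, this, ih, Nat.choose_succ_succ]
      push_cast
      field_simp
      ring

theorem four_pow_le_mul_centralBinom_sq {N : ℕ} (hN : 1 ≤ N) :
    (16 : ℝ) ^ N ≤ 4 * N * (N.centralBinom : ℝ) ^ 2 := by
  induction N, hN using Nat.le_induction with
  | base => simp [Nat.centralBinom]; norm_num
  | succ N hN ih =>
    have h := Nat.succ_mul_centralBinom_succ N
    have h' : ((N : ℝ) + 1) * ((N + 1).centralBinom : ℝ) = 2 * (2 * N + 1) * N.centralBinom := by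
      exact_mod_cast h
    have hN' : (1 : ℝ) ≤ N := by exact_mod_cast hN
    have e : ((N + 1).centralBinom : ℝ) = 2 * (2 * N + 1) * N.centralBinom / (N + 1) := by
      field_simp; linarith
    rw [pow_succ, e]
    push_cast
    have : 4 * ((N : ℝ) + 1) * (2 * (2 * N + 1) * N.centralBinom / (N + 1)) ^ 2 =
        16 * (2 * N + 1) ^ 2 / (N + 1) * (N.centralBinom : ℝ) ^ 2 := by
      field_simp; ring
    rw [this]
    have h2 : 16 * (4 * (N : ℝ)) ≤ 16 * (2 * N + 1) ^ 2 / (N + 1) := by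
      rw [le_div_iff₀ (by positivity)]; nlinarith
    calc (16 : ℝ) ^ N * 16 ≤ 4 * N * (N.centralBinom : ℝ) ^ 2 * 16 := by gcongr
      _ = 16 * (4 * (N : ℝ)) * (N.centralBinom : ℝ) ^ 2 := by ring
      _ ≤ _ := by gcongr

theorem centralBinom_ge {N : ℕ} (hN : 1 ≤ N) :
    1 / (2 * √N) ≤ (N.centralBinom : ℝ) / 4 ^ N := by
  have hN' : (0 : ℝ) < N := by exact_mod_cast hN
  rw [div_le_div_iff₀ (by positivity) (by positivity), one_mul]
  refine abs_le_of_sq_le_sq' ?_ (by positivity) |>.2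
  have := four_pow_le_mul_centralBinom_sq hN
  rw [mul_pow, mul_pow, Real.sq_sqrt hN'.le, ← pow_mul, mul_comm N 2, pow_mul]
  norm_num
  linarith

/-- Induction on `y` through the ratio `(N - y) / (N + y + 1)` of consecutive coefficients. The loss
at each step is absorbed because the relevant polynomials differ by `y³ + (y + 1)³ ≥ 0`. -/
theorem mul_choose_add_ge (N y : ℕ) (hy : y ≤ N) :
    (N.centralBinom : ℝ) * (N - (y : ℝ) ^ 2) ≤ N * ((2 * N).choose (N + y) : ℝ) := by
  induction y with
  | zero => simp [Nat.centralBinom, mul_comm]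
  | succ y ih =>
    have ih := ih (by omega)
    have h := Nat.choose_succ_right_eq (2 * N) (N + y)
    have hy' : (y : ℝ) + 1 ≤ N := by exact_mod_cast hy
    have h' : ((2 * N).choose (N + (y + 1)) : ℝ) * (N + y + 1) =
        (2 * N).choose (N + y) * (N - y) := by
      have e : 2 * N - (N + y) = N - y := by omega
      rw [e] at h
      have := congrArg (Nat.cast : ℕ → ℝ) h
      push_cast [Nat.cast_sub (show y ≤ N by omega)] at this
      rw [← add_assoc]
      exact this
    have hp : (0 : ℝ) < N + y + 1 := by positivity
    refine le_of_mul_le_mul_right ?_ hp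
    have hc : (0 : ℝ) ≤ N.centralBinom := Nat.cast_nonneg _
    have h0 := mul_le_mul_of_nonneg_right ih (show (0 : ℝ) ≤ N - y by linarith)
    have hpoly : ((N : ℝ) - ((y : ℝ) + 1) ^ 2) * (N + y + 1) ≤ (N - (y : ℝ) ^ 2) * (N - y) := by
      have hy0 : (0 : ℝ) ≤ y := Nat.cast_nonneg _
      have : (N - (y : ℝ) ^ 2) * (N - y) - ((N : ℝ) - ((y : ℝ) + 1) ^ 2) * (N + y + 1) =
        (y : ℝ) ^ 3 + (y + 1) ^ 3 := by ring
      have : (0 : ℝ) ≤ (y : ℝ) ^ 3 + (y + 1) ^ 3 := by positivity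
      linarith
    have h1 := mul_le_mul_of_nonneg_left hpoly hc
    push_cast
    calc _ ≤ (N.centralBinom : ℝ) * ((N - (y : ℝ) ^ 2) * (N - y)) := by
          rw [mul_assoc]; exact h1
      _ ≤ N * ((2 * N).choose (N + y) : ℝ) * (N - y) := by rw [← mul_assoc]; exact h0
      _ = N * (((2 * N).choose (N + (y + 1)) : ℝ) * (N + y + 1)) := by rw [h']; ring
      _ = _ := by ring

theorem coinProb_ge {N : ℕ} (hN : 1 ≤ N) {x : ℤ} (hx : 2 * x ^ 2 ≤ N) :
    1 / (4 * √N) ≤ coinProb (2 * N) (N + x) := by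
  have key : ∀ y : ℕ, 2 * y ^ 2 ≤ N → 1 / (4 * √N) ≤ ((2 * N).choose (N + y) : ℝ) / 4 ^ N := by
    intro y hy
    have hyN : y ≤ N := by nlinarith
    have h := mul_choose_add_ge N y hyN
    have hc := centralBinom_ge hN
    have hN' : (0 : ℝ) < N := by exact_mod_cast hN
    have hy' : 2 * (y : ℝ) ^ 2 ≤ N := by exact_mod_cast hy
    have h2 : (N.centralBinom : ℝ) / 2 ≤ (2 * N).choose (N + y) := by
      refine le_of_mul_le_mul_left (le_trans ?_ h) hN'
      have hc : (0 : ℝ) ≤ N.centralBinom := Nat.cast_nonneg _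
      nlinarith
    calc 1 / (4 * √N) = 1 / (2 * √N) / 2 := by rw [div_div]; congr 1; ring
      _ ≤ (N.centralBinom : ℝ) / 4 ^ N / 2 := by gcongr
      _ = (N.centralBinom : ℝ) / 2 / 4 ^ N := by ring
      _ ≤ _ := by gcongr
  have hx' : 2 * x.natAbs ^ 2 ≤ N := by zify; rwa [sq_abs]
  have h := key _ hx'
  have hle : x.natAbs ≤ N := by nlinarith
  have hpow : (2 : ℝ) ^ (2 * N) = 4 ^ N := by rw [pow_mul]; norm_num
  rcases Int.natAbs_eq x with e | e
  · rw [e, ← Nat.cast_add, coinProb_natCast, hpow]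
    exact h
  · rw [e, ← sub_eq_add_neg, ← Nat.cast_sub hle, coinProb_natCast, hpow]
    rwa [← Nat.choose_symm_of_eq_add (show 2 * N = (N + x.natAbs) + (N - x.natAbs) by omega)]

end Binomial

/-! ### Heat kernel and Green function lower bounds on `ℤ⁴`. -/

section HeatKernel

/-- The probability that the walk is at `x` after `N i` steps along each coordinate `i`. -/
noncomputable def coordProb (N : Fin 4 → ℕ) (x : Fin 4 → ℤ) : ℝ :=
  ∏ i, coinProb (2 * N i) (N i + x i)

/-- A lazy step along one coordinate has the law of two fair coins minus one, so it advances
`coinProb` by two tosses and shifts the centre by one. -/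
theorem sum_coordProb (N : Fin 4 → ℕ) (x : Fin 4 → ℤ) (i : Fin 4) :
    (∑ r, coordProb N (x - stepVec (i, r))) / 4 = coordProb (N + Pi.single i 1) x := by
  have h1 : ∀ r, coordProb N (x - stepVec (i, r)) =
      coinProb (2 * N i) (N i + x i - stepSign r) *
        ∏ j ∈ Finset.univ.erase i, coinProb (2 * N j) (N j + x j) := by
    intro r
    rw [coordProb, ← Finset.mul_prod_erase _ _ (Finset.mem_univ i)]
    congr 1
    · simp [stepVec, add_sub_assoc]
    · refine Finset.prod_congr rfl fun j hj => ?_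
      simp [stepVec, Finset.ne_of_mem_erase hj]
  have h2 : coordProb (N + Pi.single i 1) x = coinProb (2 * (N i + 1)) ((N i + 1 : ℕ) + x i) *
        ∏ j ∈ Finset.univ.erase i, coinProb (2 * N j) (N j + x j) := by
    rw [coordProb, ← Finset.mul_prod_erase _ _ (Finset.mem_univ i)]
    congr 1
    · simp
    · refine Finset.prod_congr rfl fun j hj => ?_
      simp [Finset.ne_of_mem_erase hj]
  simp only [h1, h2, ← Finset.sum_mul]
  have e1 : ((N i + 1 : ℕ) : ℤ) + x i - 1 = N i + x i := by push_cast; ring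
  have e2 : ((N i + 1 : ℕ) : ℤ) + x i = N i + x i + 1 := by push_cast; ring
  simp only [Nat.mul_succ, coinProb, e2, add_sub_cancel_right, Fin.sum_univ_four, stepSign]
  simp
  ring

/-- Condition on which coordinate is chosen at each time. The four coordinates are then independent
and only the counts matter. -/
theorem listMean_eq_coordProb (T : ℕ) (x : Fin 4 → ℤ) :
    listMean T (fun l : List Step => if (l.map stepVec).sum = x then (1 : ℝ) else 0) =
      listMean T (fun c : List (Fin 4) => coordProb (fun i => c.count i) x) := by
  induction T generalizing x with
  | zero =>
    simp only [listMean, coordProb, coinProb, List.map_nil, List.sum_nil, List.count_nil,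
      Nat.mul_zero, Nat.cast_zero, zero_add, Finset.prod_ite_zero, Finset.prod_const_one,
      Finset.mem_univ, true_implies]
    congr 1
    simp [funext_iff, eq_comm]
  | succ T ih =>
    have h : ∀ s : Step, listMean T
        (fun l => if ((s :: l).map stepVec).sum = x then (1 : ℝ) else 0) =
        listMean T (fun c : List (Fin 4) => coordProb (fun i => c.count i) (x - stepVec s)) := by
      intro s
      rw [← ih]
      simp only [List.map_cons, List.sum_cons, eq_sub_iff_add_eq']
    have h2 : ∀ (i : Fin 4) (c : List (Fin 4)), (fun j => (i :: c).count j) =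
        (fun j => c.count j) + Pi.single i 1 := by
      intro i c
      ext j
      by_cases hj : j = i
      · subst hj; simp
      · simp [hj, Ne.symm hj]
    simp only [listMean, h, h2, ← sum_coordProb, listMean_div_const, listMean_sum,
      Fintype.sum_prod_type, ← Finset.sum_div]
    simp [div_div]
    norm_num

theorem listMean_count (i : Fin 4) (T : ℕ) :
    listMean T (fun c : List (Fin 4) => (c.count i : ℝ) - T / 4) = 0 := by
  induction T with
  | zero => simp [listMean]
  | succ T ih =>
    have h : ∀ s : Fin 4, listMean T (fun c => ((s :: c).count i : ℝ) - (T + 1 : ℕ) / 4) =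
        (if s = i then 1 else 0) - 1 / 4 := by
      intro s
      have : ∀ c : List (Fin 4), ((s :: c).count i : ℝ) - (T + 1 : ℕ) / 4 =
          ((c.count i : ℝ) - T / 4) + ((if s = i then 1 else 0) - 1 / 4) := by
        intro c
        simp only [List.count_cons, beq_iff_eq]
        split_ifs <;> push_cast <;> ring
      simp only [this, listMean_add, ih, listMean_const, zero_add]
    simp only [listMean, h]
    simp

theorem listMean_count_sq (i : Fin 4) (T : ℕ) :
    listMean T (fun c : List (Fin 4) => ((c.count i : ℝ) - T / 4) ^ 2) = 3 * T / 16 := by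
  induction T with
  | zero => simp [listMean]
  | succ T ih =>
    have h : ∀ s : Fin 4, listMean T (fun c => (((s :: c).count i : ℝ) - (T + 1 : ℕ) / 4) ^ 2) =
        3 * T / 16 + ((if s = i then 1 else 0) - 1 / 4) ^ 2 := by
      intro s
      have : ∀ c : List (Fin 4), (((s :: c).count i : ℝ) - (T + 1 : ℕ) / 4) ^ 2 =
          ((c.count i : ℝ) - T / 4) ^ 2 +
          (2 * ((if s = i then 1 else 0) - 1 / 4) * ((c.count i : ℝ) - T / 4) +
            ((if s = i then 1 else 0) - 1 / 4) ^ 2) := by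
        intro c
        simp only [List.count_cons, beq_iff_eq]
        split_ifs <;> push_cast <;> ring
      simp only [this, listMean_add, listMean_const_mul, listMean_count, listMean_const, ih]
      ring
    have h4 : ∑ s : Fin 4, ((if s = i then 1 else 0 : ℝ) - 1 / 4) ^ 2 = 3 / 4 := by
      fin_cases i <;> simp [Fin.sum_univ_four] <;> norm_num
    simp only [listMean, h, Finset.sum_add_distrib, h4]
    simp
    ring

theorem coordProb_nonneg (N : Fin 4 → ℕ) (x : Fin 4 → ℤ) : 0 ≤ coordProb N x :=
  Finset.prod_nonneg fun _ _ => coinProb_nonneg _ _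

theorem coordProb_ge {T : ℕ} (hT : 1 ≤ T) {N : Fin 4 → ℕ} {x : Fin 4 → ℤ}
    (hN : ∀ i, T ≤ 8 * N i) (hN' : ∀ i, N i ≤ T) (hx : ∀ i, 16 * x i ^ 2 ≤ T) :
    1 / (256 * (T : ℝ) ^ 2) ≤ coordProb N x := by
  have hT' : (0 : ℝ) < T := by exact_mod_cast hT
  have h : ∀ i, 1 / (4 * √T) ≤ coinProb (2 * N i) (N i + x i) := by
    intro i
    have h1 : 1 ≤ N i := by have := hN i; omega
    have h1' : (0 : ℝ) < N i := by exact_mod_cast h1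
    refine le_trans ?_ (coinProb_ge h1 (x := x i) ?_)
    · gcongr
      exact hN' i
    · have := hN i; have := hx i; omega
  calc 1 / (256 * (T : ℝ) ^ 2) = ∏ _i : Fin 4, 1 / (4 * √(T : ℝ)) := by
        have : √(T : ℝ) ^ 4 = (T : ℝ) ^ 2 := by
          rw [show 4 = 2 * 2 by norm_num, pow_mul, Real.sq_sqrt hT'.le]
        simp only [Finset.prod_const, Finset.card_univ, Fintype.card_fin, div_pow, mul_pow, this]
        norm_num
    _ ≤ _ := Finset.prod_le_prod (fun _ _ => by positivity) fun i _ => h i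

theorem heatKernel_ge {T : ℕ} (hT : 96 ≤ T) {x : Fin 4 → ℤ} (hx : ∀ i, 16 * x i ^ 2 ≤ T) :
    1 / (512 * (T : ℝ) ^ 2) ≤
      listMean T (fun l : List Step => if (l.map stepVec).sum = x then (1 : ℝ) else 0) := by
  have hT' : (96 : ℝ) ≤ T := by exact_mod_cast hT
  rw [listMean_eq_coordProb]
  -- A Chebyshev bound in pointwise form: a count below `T / 8` deviates from `T / 4` by at least `T
  -- / 8`, so the bracket is nonpositive unless every count is large. Its mean is `1 - 48 / T`, at
  -- least 1/2 once `T ≥ 96`.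
  have key : ∀ c : List (Fin 4), c.length = T →
      1 / (256 * (T : ℝ) ^ 2) * (1 + -64 / (T : ℝ) ^ 2 * ∑ i, ((c.count i : ℝ) - T / 4) ^ 2) ≤
        coordProb (fun i => c.count i) x := by
    intro c hc
    by_cases hg : ∀ i, T ≤ 8 * c.count i
    · refine le_trans ?_ (coordProb_ge (by omega) hg (fun i => hc ▸ List.count_le_length) hx)
      refine mul_le_of_le_one_right (by positivity) ?_
      have : 0 ≤ ∑ i, ((c.count i : ℝ) - T / 4) ^ 2 := Finset.sum_nonneg fun _ _ => sq_nonneg _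
      have := mul_nonneg (show 0 ≤ 64 / (T : ℝ) ^ 2 by positivity) this
      rw [neg_div, neg_mul]
      linarith
    · refine le_trans (mul_nonpos_of_nonneg_of_nonpos (by positivity) ?_) (coordProb_nonneg _ _)
      push Not at hg
      obtain ⟨i, hi⟩ := hg
      have hi' : 8 * (c.count i : ℝ) ≤ T := by exact_mod_cast hi.le
      have h1 : (T : ℝ) ^ 2 / 64 ≤ ∑ i, ((c.count i : ℝ) - T / 4) ^ 2 := by
        refine le_trans ?_ (Finset.single_le_sum (f := fun i => ((c.count i : ℝ) - T / 4) ^ 2)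
          (fun _ _ => sq_nonneg _) (Finset.mem_univ i))
        nlinarith
      have h2 := mul_le_mul_of_nonneg_left h1 (show 0 ≤ 64 / (T : ℝ) ^ 2 by positivity)
      have h3 : 64 / (T : ℝ) ^ 2 * ((T : ℝ) ^ 2 / 64) = 1 := by field_simp
      rw [neg_div, neg_mul]
      linarith
  refine le_trans ?_ (listMean_mono key)
  rw [listMean_const_mul, listMean_add, listMean_const, listMean_const_mul, listMean_sum]
  simp only [listMean_count_sq, Finset.sum_const, Finset.card_univ, Fintype.card_fin, nsmul_eq_mul]
  have h1 : (1 : ℝ) / 2 ≤ 1 + -64 / (T : ℝ) ^ 2 * ((4 : ℕ) * (3 * T / 16)) := by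
    have : 1 + -64 / (T : ℝ) ^ 2 * ((4 : ℕ) * (3 * T / 16)) = 1 - 48 / T := by
      push_cast; field_simp; ring
    rw [this]
    have : 48 / (T : ℝ) ≤ 1 / 2 := by rw [div_le_div_iff₀ (by linarith) (by norm_num)]; linarith
    linarith
  calc 1 / (512 * (T : ℝ) ^ 2) = 1 / (256 * (T : ℝ) ^ 2) * (1 / 2) := by
        field_simp; norm_num
    _ ≤ _ := by gcongr

theorem green_stepVec_ge {r : ℕ} {x : Fin 4 → ℤ} (hr : 192 * (1 + normSq x) ≤ r) :
    1 / (196608 * (1 + normSq x)) ≤ green stepVec r x := by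
  obtain ⟨m, hm⟩ : ∃ m : ℕ, normSq x = m := ⟨∑ i, (x i).natAbs ^ 2, by
    simp [normSq, Nat.cast_natAbs]⟩
  rw [hm] at hr ⊢
  have hr' : 192 * (1 + m) ≤ r := by exact_mod_cast hr
  have hx : ∀ i, x i ^ 2 ≤ m := by
    intro i
    have : (x i : ℝ) ^ 2 ≤ m := by
      rw [← hm]
      exact Finset.single_le_sum (f := fun i => (x i : ℝ) ^ 2) (fun _ _ => sq_nonneg _)
        (Finset.mem_univ i)
    exact_mod_cast this
  -- At the times from `τ` to `2 * τ - 1` the heat kernel bound applies and is of order `τ⁻²`;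
  -- summing `τ` such terms leaves order `1 / (1 + |x|²)`.
  set τ := 96 * (1 + m) with hτ
  have hτ' : (τ : ℝ) = 96 * (1 + m) := by rw [hτ]; push_cast; ring
  have hpos : (0 : ℝ) < τ := by rw [hτ']; positivity
  calc 1 / (196608 * (1 + (m : ℝ))) = ∑ _i ∈ Finset.Ico τ (2 * τ), 1 / (512 * (2 * τ : ℝ) ^ 2) := by
        rw [Finset.sum_const, Nat.card_Ico, show 2 * τ - τ = τ by omega, nsmul_eq_mul]
        have : (1 + (m : ℝ)) = τ / 96 := by rw [hτ']; ring
        rw [this]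
        field_simp
        norm_num
    _ ≤ ∑ i ∈ Finset.Ico τ (2 * τ), listMean i
          (fun l : List Step => if (l.map stepVec).sum = x then (1 : ℝ) else 0) := by
        refine Finset.sum_le_sum fun i hi => ?_
        obtain ⟨h1, h2⟩ := Finset.mem_Ico.1 hi
        have hi0 : (0 : ℝ) < i := by
          have : (τ : ℝ) ≤ i := by exact_mod_cast h1
          linarith
        refine le_trans ?_ (heatKernel_ge (by omega) fun j => by have := hx j; omega)
        gcongr
        exact_mod_cast h2.le
    _ ≤ _ := by
        refine Finset.sum_le_sum_of_subset_of_nonneg (fun i hi => ?_) fun _ _ _ =>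
          listMean_nonneg fun _ => by split_ifs <;> norm_num
        have := (Finset.mem_Ico.1 hi).2
        exact Finset.mem_range.2 (by omega)

end HeatKernel

end TorusWalk
namespace TorusWalk

/-! ### Mean hitting probability of one block. -/

section FirstMoment

theorem normSq_walkPos_le (l : List Step) (k : ℕ) :
    normSq (walkPos stepVec l k) ≤ (k : ℝ) ^ 2 := by
  induction l generalizing k with
  | nil => simp [walkPos, normSq]
  | cons s l ih =>
    cases k with
    | zero => simp [normSq]
    | succ k =>
      have h : walkPos stepVec (s :: l) (k + 1) = walkPos stepVec l k + stepVec s := by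
        simp [walkPos, add_comm]
      rw [h, normSq_add_stepVec]
      have h1 := ih k
      have h2 : |(walkPos stepVec l k s.1 : ℝ)| ≤ k := by
        refine abs_le_of_sq_le_sq (le_trans ?_ h1) (Nat.cast_nonneg k)
        exact Finset.single_le_sum (f := fun i => (walkPos stepVec l k i : ℝ) ^ 2)
          (fun _ _ => sq_nonneg _) (Finset.mem_univ s.1)
      obtain ⟨h3, h4⟩ := abs_le.1 h2
      have h5 : (stepSign s.2 : ℝ) = 0 ∨ (stepSign s.2 : ℝ) = 1 ∨ (stepSign s.2 : ℝ) = -1 := by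
        generalize s.2 = r
        fin_cases r <;> simp [stepSign]
      push_cast
      rcases h5 with h5 | h5 | h5 <;> rw [h5] <;> nlinarith

variable {G : Type*} [AddCommGroup G] [DecidableEq G] (f : (Fin 4 → ℤ) →+ G)

/-- Only the `κ` positions following time `j` are used. They lie within distance `κ` of the position
at `j`, so a horizon of `384 * κ ^ 2` is long enough for the Green function bound at each of them.
-/
theorem sum_green_ge {κ : ℕ} (hκ : 1 ≤ κ) {l : List Step} {j m : ℕ} (hm : j + κ < m)
    (hgood : normMartSum κ (l.drop j) ≤ harmonicSum κ) :
    harmonicSum κ / 491520 ≤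
      ∑ k ∈ Finset.range m, green (fun s => f (stepVec s)) (384 * κ ^ 2)
        (walkPos (fun s => f (stepVec s)) l k - walkPos (fun s => f (stepVec s)) l j) := by
  set v := fun s => f (stepVec s)
  have hκ' : (1 : ℝ) ≤ κ := by exact_mod_cast hκ
  calc harmonicSum κ / 491520 = 1 / 196608 * (2 / 5 * harmonicSum κ) := by ring
    _ ≤ 1 / 196608 * ∑ k ∈ Finset.range κ,
          1 / (1 + normSq (walkPos stepVec (l.drop j) (k + 1))) := by
        gcongr
        exact sum_inv_one_add_normSq_ge hκ hgood
    _ ≤ ∑ k ∈ Finset.range κ, green v (384 * κ ^ 2) (walkPos v l (j + (k + 1)) - walkPos v l j) := by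
        rw [Finset.mul_sum]
        refine Finset.sum_le_sum fun k hk => ?_
        rw [← walkPos_drop, ← map_walkPos stepVec f]
        refine le_trans ?_ (green_le_green_map stepVec f _ _)
        rw [one_div_mul_one_div]
        refine green_stepVec_ge ?_
        have h1 := normSq_walkPos_le (l.drop j) (k + 1)
        have h2 : ((k + 1 : ℕ) : ℝ) ≤ κ := by exact_mod_cast Finset.mem_range.1 hk
        have h3 : ((k + 1 : ℕ) : ℝ) ^ 2 ≤ (κ : ℝ) ^ 2 := by gcongr
        push_cast at *
        nlinarith
    _ = ∑ k ∈ (Finset.range κ).map ⟨fun k => j + (k + 1), fun a b h => by simpa using h⟩,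
          green v (384 * κ ^ 2) (walkPos v l k - walkPos v l j) := by
        rw [Finset.sum_map]
        rfl
    _ ≤ _ := by
        refine Finset.sum_le_sum_of_subset_of_nonneg (fun k hk => ?_) fun _ _ _ => green_nonneg _ _ _
        obtain ⟨i, hi, rfl⟩ := Finset.mem_map.1 hk
        have := Finset.mem_range.1 hi
        refine Finset.mem_range.2 (show j + (i + 1) < m from ?_)
        omega

variable [Fintype G]

open Classical in
-- The block is prolonged by `κ` steps so that every time `j ≤ b` has a future of length `κ`.
-- Positions at good times are treated by `mul_meanHit_le`, with the prolonged path as targets;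
-- those at bad times by their number.
theorem meanHit_take_le {κ b : ℕ} (hκ : 1 ≤ κ) (hb : b = 384 * κ ^ 2) {l : List Step}
    (hl : l.length = b + κ) :
    meanHit (fun s => f (stepVec s)) b (visited (fun s => f (stepVec s)) 0 (l.take b)) ≤
      491520 * ((2 * b + 1) * (b + κ + 1)) / (Fintype.card G * harmonicSum κ) +
      (b + 1) / Fintype.card G * ∑ j ∈ Finset.range (b + 1),
        if harmonicSum κ < normMartSum κ ((l.drop j).take κ) then 1 else 0 := by
  set v := fun s => f (stepVec s)
  have hH := harmonicSum_pos hκ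
  have htake : ∀ j, j ≤ b → normMartSum κ ((l.drop j).take κ) = normMartSum κ (l.drop j) := by
    intro j hj
    conv_rhs => rw [← List.take_append_drop κ (l.drop j)]
    rw [normMartSum_append]
    simp only [List.length_take, List.length_drop, hl]
    omega
  set good := (Finset.range (b + 1)).filter fun j => normMartSum κ (l.drop j) ≤ harmonicSum κ
  set bad := (Finset.range (b + 1)).filter fun j => ¬ normMartSum κ (l.drop j) ≤ harmonicSum κ
  have hsub : visited v 0 (l.take b) ⊆ good.image (walkPos v l) ∪ bad.image (walkPos v l) := by
    intro x hx
    obtain ⟨k, hk, rfl⟩ := (mem_visited v).1 hx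
    have hkb : k ≤ b := hk.trans (List.length_take_le _ _)
    rw [walkPos_take v l hkb, zero_add, ← Finset.image_union, Finset.filter_union_filter_not_eq]
    exact Finset.mem_image_of_mem _ (Finset.mem_range.2 (by omega))
  refine (meanHit_mono v b hsub).trans ((meanHit_union_le v b _ _).trans (add_le_add ?_ ?_))
  · have h := mul_meanHit_le v (walkPos v l) (b + κ + 1) b b (δ := harmonicSum κ / 491520)
      (B := good.image (walkPos v l)) (fun z hz => by
        obtain ⟨j, hj, rfl⟩ := Finset.mem_image.1 hz
        obtain ⟨hj1, hj2⟩ := Finset.mem_filter.1 hj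
        rw [hb]
        refine sum_green_ge f hκ ?_ hj2
        have := Finset.mem_range.1 hj1
        omega)
    rw [div_mul_eq_mul_div, div_le_iff₀ (by norm_num), mul_comm, ← le_div_iff₀ hH] at h
    refine h.trans (le_of_eq ?_)
    push_cast
    field_simp
    ring
  · refine (meanHit_le_card v b _).trans ?_
    rw [mul_div_right_comm]
    gcongr
    have h1 : (∑ j ∈ Finset.range (b + 1),
        if harmonicSum κ < normMartSum κ ((l.drop j).take κ) then (1 : ℝ) else 0) = bad.card := by
      rw [Finset.card_filter]
      push_cast
      refine Finset.sum_congr rfl fun j hj => ?_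
      rw [htake j (by have := Finset.mem_range.1 hj; omega)]
      simp only [not_le]
    rw [h1]
    exact_mod_cast Finset.card_image_le

theorem listMean_meanHit_block_le {κ b : ℕ} (hκ : 1 ≤ κ) (hb : b = 384 * κ ^ 2) :
    listMean b (fun l => meanHit (fun s => f (stepVec s)) b
      (visited (fun s => f (stepVec s)) 0 l)) ≤
      5000000 * (b : ℝ) ^ 2 / (Fintype.card G * harmonicSum κ) := by
  classical
  have hH := harmonicSum_pos hκ
  rw [← listMean_take b κ]
  refine (listMean_mono fun l hl => meanHit_take_le f hκ hb hl).trans ?_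
  rw [listMean_add, listMean_const, listMean_const_mul, listMean_sum]
  have h1 : ∀ j ∈ Finset.range (b + 1), listMean (b + κ) (fun l : List Step =>
      if harmonicSum κ < normMartSum κ ((l.drop j).take κ) then (1 : ℝ) else 0) ≤
      1 / harmonicSum κ := by
    intro j hj
    obtain ⟨d, hd⟩ := Nat.exists_eq_add_of_le (Nat.lt_succ_iff.1 (Finset.mem_range.1 hj))
    have e : b + κ = j + (κ + d) := by omega
    -- Stationarity of the increments: the `κ` steps after time `j` are distributed like a fresh
    -- list, so being bad has the same probability at every `j`.
    rw [e, listMean_drop j (κ + d) (fun l : List Step =>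
      if harmonicSum κ < normMartSum κ (l.take κ) then (1 : ℝ) else 0),
      listMean_take κ d (fun l : List Step =>
      if harmonicSum κ < normMartSum κ l then (1 : ℝ) else 0)]
    exact listMean_normMartSum_gt_le hκ
  have h2 := Finset.sum_le_sum h1
  rw [Finset.sum_const, Finset.card_range, nsmul_eq_mul] at h2
  have hκ' : (1 : ℝ) ≤ κ := by exact_mod_cast hκ
  have hb' : (b : ℝ) = 384 * (κ : ℝ) ^ 2 := by rw [hb]; push_cast; ring
  have hbκ : (κ : ℝ) ≤ b := by nlinarith
  have hb1 : (1 : ℝ) ≤ b := hκ'.trans hbκ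
  have hN : (0 : ℝ) < Fintype.card G := by exact_mod_cast Fintype.card_pos
  calc _ ≤ 491520 * ((2 * b + 1) * (b + κ + 1)) / (Fintype.card G * harmonicSum κ) +
        (b + 1) / Fintype.card G * (((b + 1 : ℕ) : ℝ) * (1 / harmonicSum κ)) := by gcongr
    _ = (491520 * ((2 * b + 1) * (b + κ + 1)) + (b + 1) * (b + 1)) /
          (Fintype.card G * harmonicSum κ) := by push_cast; field_simp
    _ ≤ _ := by
        gcongr
        nlinarith

end FirstMoment

/-! ### Second moment by cutting into independent blocks. -/

section SecondMoment

variable {S G : Type*} [Fintype S] [AddCommGroup G] [DecidableEq G] [Fintype G] (v : S → G)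

theorem meanHit_visited_append_le (K : ℕ) (l l' : List S) :
    meanHit v K (visited v 0 (l ++ l')) ≤
      meanHit v K (visited v 0 l) + meanHit v K (visited v 0 l') := by
  rw [visited_append, ← meanHit_visited v K (0 + (l.map v).sum) l']
  exact meanHit_union_le ..

variable [Nonempty S]

theorem listMean_meanHit_mul_le (K b Q : ℕ) (hQ : 1 ≤ Q) :
    listMean (Q * b) (fun l => meanHit v K (visited v 0 l)) ≤
      Q * listMean b (fun l => meanHit v K (visited v 0 l)) := by
  induction Q, hQ using Nat.le_induction with
  | base => simp
  | succ Q _ ih =>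
    rw [add_mul, one_mul, listMean_append]
    refine (listMean_mono fun l _ => listMean_mono fun l' _ =>
      meanHit_visited_append_le v K l l').trans ?_
    simp only [listMean_add, listMean_const]
    push_cast
    linarith

/-- Add one block at a time. By translation invariance the contribution of the new block depends on
its own steps only, so the cross terms factor into products of means; the diagonal term is bounded
crudely by cardinality. -/
theorem listMean_meanHit_mul_meanHit_le (K L b Q : ℕ) (hQ : 1 ≤ Q) :
    listMean (Q * b) (fun l => meanHit v K (visited v 0 l) * meanHit v L (visited v 0 l)) ≤
      Q * ((K + 1) * (b + 1) / Fintype.card G * ((L + 1) * (b + 1) / Fintype.card G)) +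
        Q ^ 2 * (listMean b (fun l => meanHit v K (visited v 0 l)) *
          listMean b (fun l => meanHit v L (visited v 0 l))) := by
  have hbase : listMean b (fun l => meanHit v K (visited v 0 l) * meanHit v L (visited v 0 l)) ≤
      (K + 1) * (b + 1) / Fintype.card G * ((L + 1) * (b + 1) / Fintype.card G) := by
    rw [← listMean_const (S := S) b
      ((K + 1) * (b + 1) / Fintype.card G * ((L + 1) * (b + 1) / Fintype.card G) : ℝ)]
    refine listMean_mono fun l hl => ?_
    have hc : ((visited v 0 l).card : ℝ) ≤ b + 1 := by
      have := card_visited_le v 0 l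
      rw [hl] at this
      exact_mod_cast this
    have hle : ∀ T : ℕ, meanHit v T (visited v 0 l) ≤ (T + 1) * (b + 1) / Fintype.card G :=
      fun T => (meanHit_le_card v T _).trans (by gcongr)
    exact mul_le_mul (hle K) (hle L) (meanHit_nonneg ..) (by positivity)
  have ha : ∀ T, 0 ≤ listMean b (fun l => meanHit v T (visited v 0 l)) :=
    fun T => listMean_nonneg fun _ => meanHit_nonneg ..
  induction Q, hQ using Nat.le_induction with
  | base =>
    have := mul_nonneg (ha K) (ha L)
    simp only [one_mul, Nat.cast_one, one_pow]
    linarith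
  | succ Q hQ ih =>
    rw [add_mul, one_mul, listMean_append]
    have h1 : listMean (Q * b) (fun l => listMean b fun l' =>
        meanHit v K (visited v 0 (l ++ l')) * meanHit v L (visited v 0 (l ++ l'))) ≤
        listMean (Q * b) (fun l => listMean b fun l' =>
          (meanHit v K (visited v 0 l) * meanHit v L (visited v 0 l) +
            (meanHit v K (visited v 0 l) * meanHit v L (visited v 0 l') +
              meanHit v L (visited v 0 l) * meanHit v K (visited v 0 l') +
            meanHit v K (visited v 0 l') * meanHit v L (visited v 0 l')))) := by
      refine listMean_mono fun l _ => listMean_mono fun l' _ => ?_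
      refine (mul_le_mul (meanHit_visited_append_le v K l l') (meanHit_visited_append_le v L l l')
        (meanHit_nonneg ..) (add_nonneg (meanHit_nonneg ..) (meanHit_nonneg ..))).trans
        (le_of_eq (by ring))
    refine h1.trans ?_
    simp only [listMean_add, listMean_const, listMean_const_mul, listMean_mul_const]
    have hK := mul_le_mul_of_nonneg_right (listMean_meanHit_mul_le v K b Q hQ) (ha L)
    have hL := mul_le_mul_of_nonneg_right (listMean_meanHit_mul_le v L b Q hQ) (ha K)
    have hp := mul_nonneg (ha K) (ha L)
    push_cast
    nlinarith

theorem listMean_meanHit_mul_meanHit_mono (K L : ℕ) {M M' : ℕ} (h : M ≤ M') :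
    listMean M (fun l => meanHit v K (visited v 0 l) * meanHit v L (visited v 0 l)) ≤
      listMean M' (fun l => meanHit v K (visited v 0 l) * meanHit v L (visited v 0 l)) := by
  obtain ⟨d, rfl⟩ := Nat.exists_eq_add_of_le h
  rw [← listMean_take M d]
  refine listMean_mono fun l _ => ?_
  have hsub : visited v 0 (l.take M) ⊆ visited v 0 l := by
    conv_rhs => rw [← List.take_append_drop M l, visited_append]
    exact Finset.subset_union_left
  exact mul_le_mul (meanHit_mono v K hsub) (meanHit_mono v L hsub) (meanHit_nonneg ..)
    (meanHit_nonneg ..)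

end SecondMoment

/-! ### Choice of the block length and the final estimate. -/

section Bound

theorem log_le_four_mul_harmonicSum {n κ : ℕ} (hn : 2 ≤ n) (hκ : n < (κ + 1) ^ 4) :
    Real.log n ≤ 4 * harmonicSum κ := by
  have h1 : Real.log n ≤ Real.log (((κ + 1 : ℕ) : ℝ) ^ 4) := by
    refine Real.log_le_log (by positivity) ?_
    exact_mod_cast hκ.le
  have h2 := log_add_one_le_harmonic κ
  have h3 : ((harmonic κ : ℚ) : ℝ) = harmonicSum κ := by
    simp [harmonic, harmonicSum]
  rw [Real.log_pow] at h1
  rw [h3] at h2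
  push_cast at *
  linarith

theorem exists_root_four (n : ℕ) (hn : 2 ≤ n) : ∃ κ : ℕ, 1 ≤ κ ∧ κ ^ 4 ≤ n ∧ n < (κ + 1) ^ 4 := by
  have h1 := Nat.sqrt_le' n
  have h2 := Nat.lt_succ_sqrt' n
  have h3 := Nat.sqrt_le' n.sqrt
  have h4 := Nat.lt_succ_sqrt' n.sqrt
  refine ⟨n.sqrt.sqrt, ?_, ?_, ?_⟩
  · rw [Nat.one_le_iff_ne_zero, Ne, Nat.sqrt_eq_zero, Nat.sqrt_eq_zero]
    omega
  · calc n.sqrt.sqrt ^ 4 = (n.sqrt.sqrt ^ 2) ^ 2 := by ring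
      _ ≤ n.sqrt ^ 2 := by gcongr
      _ ≤ n := h1
  · calc n < (n.sqrt + 1) ^ 2 := h2
      _ ≤ ((n.sqrt.sqrt + 1) ^ 2) ^ 2 := by gcongr; exact h4
      _ = _ := by ring

theorem exists_listMean_meanHit_bound (C' : ℝ) (hC' : 0 < C') : ∃ C : ℝ, 0 < C ∧
    ∀ (G : Type) [AddCommGroup G] [DecidableEq G] [Fintype G] (f : (Fin 4 → ℤ) →+ G) (n : ℕ),
      2 ≤ n → Fintype.card G = n ^ 4 → ∀ K L M : ℕ,
      C' * n * Real.log n ≤ K → C' * n * Real.log n ≤ L → C' * n * Real.log n ≤ M →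
      listMean M (fun l => meanHit (fun s => f (stepVec s)) K (visited (fun s => f (stepVec s)) 0 l) *
        meanHit (fun s => f (stepVec s)) L (visited (fun s => f (stepVec s)) 0 l)) ≤
      C * K * L * (M : ℝ) ^ 2 / ((n : ℝ) ^ 8 * Real.log n ^ 2) := by
  -- Since `b ≤ 384 * n` and `log n ≥ 1 / 2`, each length `T ≥ C' n log n` satisfies `b ≤ D * T`;
  -- the summand 1 is slack.
  set D : ℝ := 768 / C' + 1 with hD
  have hDpos : 0 < D := by positivity
  refine ⟨(20000000 * (1 + D) ^ 2) ^ 2 + 8 * (1 + D) ^ 3 * D, by positivity, ?_⟩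
  intro G _ _ _ f n hn hcard K L M hK hL hM
  set v := fun s => f (stepVec s)
  -- With `κ` the integer fourth root of `n`, the block length is of order `√n`: a power of `n`, so
  -- that the harmonic sum is comparable to `log n`, yet small enough to leave room for the diagonal
  -- terms.
  obtain ⟨κ, hκ, hκn, hnκ⟩ := exists_root_four n hn
  set lam := Real.log n
  have hlam2 : (1 : ℝ) / 2 ≤ lam := by
    have h1 : Real.log 2 ≤ lam := Real.log_le_log (by norm_num) (by exact_mod_cast hn)
    have := Real.log_two_gt_d9
    linarith
  have hlam : 0 < lam := by linarith
  have hH := harmonicSum_pos hκ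
  have hlamH := log_le_four_mul_harmonicSum hn hnκ
  have hn0 : (0 : ℝ) < n := by positivity
  obtain ⟨b, hb⟩ : ∃ b, b = 384 * κ ^ 2 := ⟨_, rfl⟩
  have hκ' : (1 : ℝ) ≤ κ := by exact_mod_cast hκ
  have hκn' : (κ : ℝ) ^ 4 ≤ n := by exact_mod_cast hκn
  have hb' : (b : ℝ) = 384 * (κ : ℝ) ^ 2 := by rw [hb]; push_cast; ring
  have hb1 : (1 : ℝ) ≤ b := by nlinarith
  have hbpos : 0 < b := by exact_mod_cast (by linarith : (0 : ℝ) < b)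
  have hκ24 : (κ : ℝ) ^ 2 ≤ (κ : ℝ) ^ 4 := pow_le_pow_right₀ hκ' (by norm_num)
  have hbn : (b : ℝ) ≤ 384 * n := by rw [hb']; linarith
  -- `b` is small compared with each of the three lengths
  have hbT : ∀ T : ℕ, C' * n * lam ≤ T → (b : ℝ) ≤ D * T := by
    intro T hT
    have h0 : C' * n * (1 / 2) ≤ T := le_trans (by gcongr) hT
    have h1 : 768 / C' * (C' * n * (1 / 2)) ≤ 768 / C' * T := by gcongr
    have h2 : 768 / C' * (C' * n * (1 / 2)) = 384 * n := by field_simp; norm_num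
    rw [hD]
    have : (0 : ℝ) ≤ T := Nat.cast_nonneg _
    linarith
  -- This makes the diagonal terms, of order `K L M b / n⁸`, no larger than the target. It uses `lam
  -- ≤ 4 * κ`, so that `b * lam` is of order at most `κ³ ≤ n`.
  have hbM : b * lam ^ 2 ≤ 2 * D * M := by
    have h1 : lam ≤ 4 * κ := by
      have h : Real.log n ≤ 4 * Real.log (κ + 1) := by
        have : Real.log n ≤ Real.log (((κ : ℝ) + 1) ^ 4) :=
          Real.log_le_log hn0 (by exact_mod_cast hnκ.le)
        rwa [Real.log_pow] at this
      have h2 := Real.log_le_sub_one_of_pos (show (0 : ℝ) < κ + 1 by positivity)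
      linarith
    have h2 : (κ : ℝ) ^ 3 ≤ (κ : ℝ) ^ 4 := pow_le_pow_right₀ hκ' (by norm_num)
    have h3 : b * lam ≤ 1536 * n := by
      calc b * lam ≤ 384 * (κ : ℝ) ^ 2 * (4 * κ) := by rw [hb']; gcongr
        _ = 1536 * (κ : ℝ) ^ 3 := by ring
        _ ≤ _ := by linarith
    have h4 : 1536 / C' * (C' * n * lam) ≤ 1536 / C' * M := by gcongr
    have h5 : 1536 / C' * (C' * n * lam) = 1536 * n * lam := by field_simp
    have h6 : 2 * D * M = 1536 / C' * M + 2 * M := by rw [hD]; ring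
    have h7 : b * lam ^ 2 ≤ 1536 * n * lam := by
      rw [sq, ← mul_assoc]; gcongr
    have : (0 : ℝ) ≤ M := Nat.cast_nonneg _
    linarith
  have hq : ∀ T : ℕ, C' * n * lam ≤ T → ((T / b + 1 : ℕ) : ℝ) * b ≤ (1 + D) * T := by
    intro T hT
    have h1 : ((T / b * b : ℕ) : ℝ) ≤ T := by exact_mod_cast Nat.div_mul_le_self T b
    have := hbT T hT
    push_cast at *
    linarith
  have hTq : ∀ T : ℕ, T ≤ (T / b + 1) * b := fun T => by
    rw [mul_comm]; exact (Nat.lt_mul_div_succ T hbpos).le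
  have hmean : ∀ T : ℕ, C' * n * lam ≤ T →
      listMean b (fun l => meanHit v T (visited v 0 l)) ≤
        20000000 * (1 + D) * T * b / ((n : ℝ) ^ 4 * lam) := by
    intro T hT
    calc listMean b (fun l => meanHit v T (visited v 0 l))
        ≤ listMean b (fun l => ((T / b + 1 : ℕ) : ℝ) * meanHit v b (visited v 0 l)) :=
          listMean_mono fun l _ => (meanHit_mono_time v (hTq T) _).trans
            (meanHit_mul_le v _ b (Nat.le_add_left 1 _) _)
      _ ≤ ((T / b + 1 : ℕ) : ℝ) * (5000000 * (b : ℝ) ^ 2 / (Fintype.card G * harmonicSum κ)) := by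
          rw [listMean_const_mul]
          gcongr
          exact listMean_meanHit_block_le f hκ hb
      _ ≤ ((T / b + 1 : ℕ) : ℝ) * (5000000 * (b : ℝ) ^ 2 / ((n : ℝ) ^ 4 * (lam / 4))) := by
          rw [hcard]
          push_cast
          gcongr
          linarith
      _ = 20000000 * (((T / b + 1 : ℕ) : ℝ) * b) * b / ((n : ℝ) ^ 4 * lam) := by
          field_simp; ring
      _ ≤ 20000000 * ((1 + D) * T) * b / ((n : ℝ) ^ 4 * lam) := by
          gcongr 20000000 * ?_ * b / _
          exact hq T hT
      _ = _ := by ring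
  have hT1 : ∀ T : ℕ, C' * n * lam ≤ T → (T : ℝ) + 1 ≤ (1 + D) * T := by
    intro T hT
    have := hbT T hT
    linarith
  obtain ⟨Q, hQ⟩ : ∃ Q, Q = M / b + 1 := ⟨_, rfl⟩
  have hQb : (Q : ℝ) * b ≤ (1 + D) * M := hQ ▸ hq M hM
  refine (listMean_meanHit_mul_meanHit_mono v K L (hQ ▸ hTq M)).trans ?_
  refine (listMean_meanHit_mul_meanHit_le v K L b Q (hQ ▸ Nat.le_add_left 1 _)).trans ?_
  have hN : (Fintype.card G : ℝ) = (n : ℝ) ^ 4 := by rw [hcard]; push_cast; ring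
  rw [hN]
  have ha : ∀ T, 0 ≤ listMean b (fun l => meanHit v T (visited v 0 l)) :=
    fun T => listMean_nonneg fun _ => meanHit_nonneg ..
  have h1 : (Q : ℝ) * ((K + 1) * (b + 1) / (n : ℝ) ^ 4 * ((L + 1) * (b + 1) / (n : ℝ) ^ 4)) ≤
      8 * (1 + D) ^ 3 * D * K * L * (M : ℝ) ^ 2 / ((n : ℝ) ^ 8 * lam ^ 2) := by
    calc (Q : ℝ) * ((K + 1) * (b + 1) / (n : ℝ) ^ 4 * ((L + 1) * (b + 1) / (n : ℝ) ^ 4))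
        ≤ Q * ((1 + D) * K * (b + b) / (n : ℝ) ^ 4 * ((1 + D) * L * (b + b) / (n : ℝ) ^ 4)) := by
          gcongr
          · exact hT1 K hK
          · exact hT1 L hL
      _ = 4 * (1 + D) ^ 2 * K * L * (Q * b) * (b * lam ^ 2) / ((n : ℝ) ^ 8 * lam ^ 2) := by
          field_simp; ring
      _ ≤ 4 * (1 + D) ^ 2 * K * L * ((1 + D) * M) * (2 * D * M) / ((n : ℝ) ^ 8 * lam ^ 2) := by
          gcongr
      _ = _ := by ring
  have h2 : (Q : ℝ) ^ 2 * (listMean b (fun l => meanHit v K (visited v 0 l)) *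
      listMean b (fun l => meanHit v L (visited v 0 l))) ≤
      (20000000 * (1 + D) ^ 2) ^ 2 * K * L * (M : ℝ) ^ 2 / ((n : ℝ) ^ 8 * lam ^ 2) := by
    calc _ ≤ (Q : ℝ) ^ 2 * (20000000 * (1 + D) * K * b / ((n : ℝ) ^ 4 * lam) *
          (20000000 * (1 + D) * L * b / ((n : ℝ) ^ 4 * lam))) := by
          gcongr
          · exact ha L
          · exact hmean K hK
          · exact hmean L hL
      _ = (20000000 * (1 + D)) ^ 2 * K * L * (Q * b) ^ 2 / ((n : ℝ) ^ 8 * lam ^ 2) := by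
          field_simp
      _ ≤ (20000000 * (1 + D)) ^ 2 * K * L * ((1 + D) * M) ^ 2 / ((n : ℝ) ^ 8 * lam ^ 2) := by
          gcongr
      _ = _ := by ring
  refine (add_le_add h1 h2).trans (le_of_eq ?_)
  ring

end Bound

end TorusWalk
namespace TorusWalk

/-! ### From Markov chains to averages over step lists. -/

section Law

/-- Reduction modulo `n`. -/
def toTorus (n : ℕ) : (Fin 4 → ℤ) →+ Torus n := (Int.castAddHom (ZMod n)).compLeft (Fin 4)

/-- The displacement in the torus of a step. -/
def torusStep (n : ℕ) (s : Step) : Torus n := toTorus n (stepVec s)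

theorem torusStep_apply (n : ℕ) (i r : Fin 4) :
    torusStep n (i, r) = (stepSign r) • basisVec n i := by
  ext j
  by_cases h : j = i
  · subst h; simp [torusStep, toTorus, stepVec, basisVec]
  · simp [torusStep, toTorus, stepVec, basisVec, h]

variable {n : ℕ} [NeZero n]

theorem card_torus : Fintype.card (Torus n) = n ^ 4 := by simp [ZMod.card]

theorem stepKernel_real_singleton (x y : Torus n) :
    (stepKernel n x {y}).toReal =
      (∑ s : Step, if x + torusStep n s = y then (1 : ℝ) else 0) / 16 := by
  have hd : ∀ (c : ℝ) (a : Torus n), 0 ≤ c →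
      ENNReal.ofReal c * Measure.dirac a {y} = ENNReal.ofReal (c * if a = y then 1 else 0) := by
    intro c a hc
    rw [Measure.dirac_apply' _ (measurableSet_singleton y)]
    by_cases h : a = y <;> simp [h]
  have h2 : (1 / 2 : ℝ≥0∞) = ENNReal.ofReal (1 / 2) := by
    rw [ENNReal.ofReal_div_of_pos (by norm_num)]; simp
  have h16 : (1 / 16 : ℝ≥0∞) = ENNReal.ofReal (1 / 16) := by
    rw [ENNReal.ofReal_div_of_pos (by norm_num)]; simp
  have hi : ∀ a : Torus n, (0 : ℝ) ≤ if a = y then 1 else 0 := fun a => by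
    split_ifs <;> norm_num
  change (stepLaw n x {y}).toReal = _
  simp only [stepLaw, Measure.coe_add, Measure.coe_smul, Pi.add_apply, Pi.smul_apply, smul_eq_mul,
    Measure.finsetSum_apply]
  simp only [h2, h16]
  simp only [hd _ _ (show (0 : ℝ) ≤ 1 / 2 by norm_num), hd _ _ (show (0 : ℝ) ≤ 1 / 16 by norm_num)]
  have hnn : ∀ i, (0 : ℝ) ≤ 1 / 16 * (if x + basisVec n i = y then 1 else 0) +
      1 / 16 * (if x - basisVec n i = y then 1 else 0) := fun i => by
    have := hi (x + basisVec n i); have := hi (x - basisVec n i); positivity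
  have hs : ∀ i, ENNReal.ofReal (1 / 16 * (if x + basisVec n i = y then 1 else 0)) +
      ENNReal.ofReal (1 / 16 * (if x - basisVec n i = y then 1 else 0)) =
      ENNReal.ofReal (1 / 16 * (if x + basisVec n i = y then 1 else 0) +
        1 / 16 * (if x - basisVec n i = y then 1 else 0)) := fun i =>
    (ENNReal.ofReal_add (mul_nonneg (by norm_num) (hi _)) (mul_nonneg (by norm_num) (hi _))).symm
  simp only [hs]
  rw [← ENNReal.ofReal_sum_of_nonneg (fun i _ => hnn i),
    ← ENNReal.ofReal_add (mul_nonneg (by norm_num) (hi _)) (Finset.sum_nonneg fun i _ => hnn i),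
    ENNReal.toReal_ofReal (add_nonneg (mul_nonneg (by norm_num) (hi _))
      (Finset.sum_nonneg fun i _ => hnn i))]
  simp only [Fintype.sum_prod_type, torusStep_apply, Fin.sum_univ_four, stepSign]
  simp only [Matrix.cons_val, zero_smul, one_smul, neg_smul, add_zero, ← sub_eq_add_neg]
  ring

theorem sum_stepKernel_mul (x : Torus n) (φ : Torus n → ℝ) :
    ∑ y, (stepKernel n x {y}).toReal * φ y = (∑ s : Step, φ (x + torusStep n s)) / 16 := by
  simp only [stepKernel_real_singleton, div_mul_eq_mul_div, ← Finset.sum_div, Finset.sum_mul]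
  rw [Finset.sum_comm]
  simp

instance stepKernel_pow_isMarkovKernel (t : ℕ) : IsMarkovKernel (stepKernel n ^ t) := by
  induction t with
  | zero => exact inferInstanceAs (IsMarkovKernel Kernel.id)
  | succ t ih => exact inferInstanceAs (IsMarkovKernel ((stepKernel n ^ t) ∘ₖ stepKernel n))

theorem transProb_eq (t : ℕ) (x y : Torus n) :
    transProb n t x y =
      listMean t (fun l => if x + (l.map (torusStep n)).sum = y then 1 else 0) := by
  induction t generalizing x with
  | zero =>
    simp only [transProb, pow_zero, listMean, List.map_nil, List.sum_nil, add_zero]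
    change (Kernel.id x {y}).toReal = _
    rw [Kernel.id_apply, Measure.dirac_apply' _ (measurableSet_singleton y)]
    by_cases h : x = y <;> simp [h]
  | succ t ih =>
    rw [transProb, add_comm t 1,
      Kernel.pow_add_apply_eq_lintegral _ _ _ _ (measurableSet_singleton y), lintegral_fintype,
      ENNReal.toReal_sum fun _ _ => by finiteness]
    have := sum_stepKernel_mul x (fun b => transProb n t b y)
    simp only [ENNReal.toReal_mul, pow_one, mul_comm _ (stepKernel n x {_}).toReal]
    refine this.trans ?_
    rw [add_comm 1 t]
    simp [listMean, ih, add_assoc]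

variable {Ω : Type*} [MeasurableSpace Ω] {μ : Measure Ω} {X : ℕ → Ω → Torus n}

theorem IsWalk.measurableSet_path (hX : IsWalk n X μ) (T : ℕ) (p : ℕ → Torus n) :
    MeasurableSet {ω | ∀ i ≤ T, X i ω = p i} := by
  have : {ω | ∀ i ≤ T, X i ω = p i} = ⋂ i, ⋂ (_ : i ≤ T), X i ⁻¹' {p i} := by
    ext ω; simp
  rw [this]
  exact MeasurableSet.iInter fun i => MeasurableSet.iInter fun _ =>
    hX.measurable i (measurableSet_singleton _)

open Classical in
-- Each Markov transition is the image of one uniform step among sixteen; appending such a step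
-- extends the formula by one time unit.
theorem IsWalk.real_path (hX : IsWalk n X μ) (T : ℕ) (p : ℕ → Torus n) :
    μ.real {ω | ∀ i ≤ T, X i ω = p i} =
      ∑ x, μ.real {ω | X 0 ω = x} * listMean T (fun l =>
        if ∀ i ≤ T, x + walkPos (torusStep n) l i = p i then 1 else 0) := by
  induction T with
  | zero => simp [listMean]
  | succ T ih =>
    rw [measureReal_def, hX.markov, ENNReal.toReal_mul, ← measureReal_def, ih, Finset.sum_mul]
    refine Finset.sum_congr rfl fun x _ => ?_
    rw [mul_assoc, ← listMean_mul_const, listMean_succ_last]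
    congr 1
    refine listMean_congr fun l hl => ?_
    have hiff : ∀ s, (∀ i ≤ T + 1, x + walkPos (torusStep n) (l ++ [s]) i = p i) ↔
        (∀ i ≤ T, x + walkPos (torusStep n) l i = p i) ∧ p T + torusStep n s = p (T + 1) := by
      intro s
      have h1 : ∀ i ≤ T, walkPos (torusStep n) (l ++ [s]) i = walkPos (torusStep n) l i :=
        fun i hi => walkPos_append_left _ _ (hl ▸ hi)
      have h2 : walkPos (torusStep n) (l ++ [s]) (T + 1) =
          walkPos (torusStep n) l T + torusStep n s := by
        subst hl
        rw [walkPos_append_right, ← walkPos_length]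
        simp [walkPos]
      constructor
      · intro h
        have h3 : ∀ i ≤ T, x + walkPos (torusStep n) l i = p i := fun i hi => by
          rw [← h1 i hi]; exact h i (by omega)
        exact ⟨h3, by rw [← h3 T le_rfl, ← h _ le_rfl, h2, add_assoc]⟩
      · rintro ⟨h3, h4⟩ i hi
        rcases Nat.le_succ_iff.1 hi with h | rfl
        · rw [h1 i h, h3 i h]
        · rw [Nat.succ_eq_add_one, h2, ← add_assoc, h3 T le_rfl, h4]
    simp only [hiff, stepKernel_real_singleton]
    rcases Classical.em (∀ i ≤ T, x + walkPos (torusStep n) l i = p i) with h | h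
    · simp only [eq_true h, true_and, if_true, one_mul]
      simp
    · simp only [eq_false h, false_and, if_false, zero_mul]
      simp

/-- The path which follows `q` and then stays where it is. -/
def extendPath {T : ℕ} (q : Fin (T + 1) → Torus n) (i : ℕ) : Torus n :=
  q ⟨min i T, by omega⟩

open Classical in
-- A functional of the first `T + 1` positions is a finite combination of path indicators, which
-- reduces integrals to the path probabilities already computed.
theorem sum_extendPath (T : ℕ) {F : (ℕ → Torus n) → ℝ}
    (hF : ∀ p q, (∀ i ≤ T, p i = q i) → F p = F q) (w : ℕ → Torus n) :
    F w = ∑ q : Fin (T + 1) → Torus n,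
      (if ∀ i ≤ T, w i = extendPath q i then 1 else 0) * F (extendPath q) := by
  have hw : ∀ i ≤ T, w i = extendPath (fun j : Fin (T + 1) => w j) i := fun i hi => by
    simp [extendPath, hi]
  rw [Finset.sum_eq_single fun j : Fin (T + 1) => w j]
  · rw [if_pos hw, one_mul]
    exact hF _ _ hw
  · intro q _ hq
    rw [if_neg, zero_mul]
    intro h
    refine hq (funext fun j => ?_)
    rw [h j (by omega)]
    have : min (j : ℕ) T = j := by omega
    simp [extendPath, this]
  · simp

theorem IsWalk.integral_path [IsProbabilityMeasure μ] (hX : IsWalk n X μ) (T : ℕ)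
    {F : (ℕ → Torus n) → ℝ} (hF : ∀ p q, (∀ i ≤ T, p i = q i) → F p = F q) :
    ∫ ω, F (fun t => X t ω) ∂μ = ∑ x, μ.real {ω | X 0 ω = x} *
      listMean T (fun l => F (fun k => x + walkPos (torusStep n) l k)) := by
  classical
  have h1 : ∀ ω, F (fun t => X t ω) = ∑ q : Fin (T + 1) → Torus n,
      ({ω | ∀ i ≤ T, X i ω = extendPath q i}.indicator (fun _ => (1 : ℝ)) ω) *
        F (extendPath q) := by
    intro ω
    rw [sum_extendPath T hF]
    simp [Set.indicator_apply]
  simp only [h1]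
  rw [integral_finsetSum _ fun q _ => ((integrable_const 1).indicator
    (hX.measurableSet_path T _)).mul_const _]
  have h2 : ∀ q : Fin (T + 1) → Torus n, ∫ ω, ({ω | ∀ i ≤ T, X i ω = extendPath q i}.indicator
      (fun _ => (1 : ℝ)) ω) * F (extendPath q) ∂μ =
      ∑ x, μ.real {ω | X 0 ω = x} * listMean T (fun l =>
        (if ∀ i ≤ T, x + walkPos (torusStep n) l i = extendPath q i then 1 else 0) *
          F (extendPath q)) := by
    intro q
    rw [integral_mul_const, integral_indicator_const _ (hX.measurableSet_path T _), smul_eq_mul,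
      mul_one, hX.real_path, Finset.sum_mul]
    simp only [listMean_mul_const, mul_assoc]
  simp only [h2]
  rw [Finset.sum_comm]
  refine Finset.sum_congr rfl fun x _ => ?_
  rw [← Finset.mul_sum, ← listMean_sum]
  congr 1
  refine listMean_congr fun l _ => ?_
  rw [sum_extendPath T hF]

theorem IsWalk.real_event [IsProbabilityMeasure μ] (hX : IsWalk n X μ) (T : ℕ)
    {E : (ℕ → Torus n) → Prop} [DecidablePred E] (hE : ∀ p q, (∀ i ≤ T, p i = q i) → (E p ↔ E q))
    (hm : MeasurableSet {ω | E fun t => X t ω}) :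
    μ.real {ω | E fun t => X t ω} = ∑ x, μ.real {ω | X 0 ω = x} *
      listMean T (fun l => if E (fun k => x + walkPos (torusStep n) l k) then 1 else 0) := by
  rw [← hX.integral_path T (F := fun p => if E p then 1 else 0)
    (fun p q h => by simp only [hE p q h])]
  have : (fun ω => if E (fun t => X t ω) then (1 : ℝ) else 0) =
      {ω | E fun t => X t ω}.indicator (fun _ => (1 : ℝ)) := by
    ext ω; simp [Set.indicator_apply]
  rw [this, integral_indicator_const _ hm, smul_eq_mul, mul_one]

instance uniformOn_univ_isProbabilityMeasure :
    IsProbabilityMeasure (uniformOn (Set.univ : Set (Torus n))) :=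
  isProbabilityMeasure_uniformOn Set.finite_univ Set.univ_nonempty

theorem uniformOn_real_singleton (x : Torus n) :
    (uniformOn (Set.univ : Set (Torus n))).real {x} = 1 / Fintype.card (Torus n) := by
  rw [measureReal_def, uniformOn_univ]
  simp

instance uniformWalkLaw_isProbabilityMeasure : IsProbabilityMeasure (uniformWalkLaw n) := by
  unfold uniformWalkLaw
  infer_instance

theorem uniformWalkLaw_isWalk : IsWalk n (fun t (z : ℕ → Torus n) => z t) (uniformWalkLaw n) where
  measurable t := measurable_pi_apply t
  markov t x := by
    have h := Kernel.map_frestrictLe_trajMeasure_compProd_eq_map_trajMeasure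
      (X := fun _ => Torus n) (μ₀ := uniformOn Set.univ)
      (κ := fun t => (stepKernel n).comap (fun h => h ⟨t, Finset.mem_Iic.2 le_rfl⟩)
        (measurable_pi_apply _)) (a := t)
    have hset : {z : ℕ → Torus n | ∀ i ≤ t, z i = x i} =
        Preorder.frestrictLe (π := fun _ => Torus n) t ⁻¹' {Preorder.frestrictLe t x} := by
      ext z
      simp only [Set.mem_ofPred_eq, Set.mem_preimage, Set.mem_singleton_iff, funext_iff,
        Preorder.frestrictLe_apply, Subtype.forall, Finset.mem_Iic]
    have hset' : {z : ℕ → Torus n | ∀ i ≤ t + 1, z i = x i} =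
        (fun z : ℕ → Torus n => (Preorder.frestrictLe (π := fun _ => Torus n) t z, z (t + 1))) ⁻¹'
          ({Preorder.frestrictLe t x} ×ˢ {x (t + 1)}) := by
      rw [Set.mk_preimage_prod, ← hset]
      ext z
      simp only [Set.mem_ofPred_eq, Set.mem_inter_iff, Set.mem_preimage, Set.mem_singleton_iff]
      constructor
      · exact fun H => ⟨fun i hi => H i (by omega), H _ le_rfl⟩
      · rintro ⟨H, H'⟩ i hi
        rcases Nat.le_succ_iff.1 hi with h | rfl
        · exact H i h
        · exact H'
    have hm : Measurable (Preorder.frestrictLe (π := fun _ => Torus n) t) := by fun_prop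
    rw [hset, hset', ← Measure.map_apply (by fun_prop) ((measurableSet_singleton _).prod
      (measurableSet_singleton _)), uniformWalkLaw, ← h,
      Measure.compProd_apply_prod (measurableSet_singleton _) (measurableSet_singleton _),
      Measure.restrict_singleton, lintegral_smul_measure, lintegral_dirac, smul_eq_mul,
      Measure.map_apply hm (measurableSet_singleton _)]
    rfl

theorem uniformWalkLaw_real_zero (x : Torus n) :
    (uniformWalkLaw n).real {z | z 0 = x} = 1 / Fintype.card (Torus n) := by
  rw [← uniformOn_real_singleton x, measureReal_def, measureReal_def]
  congr 1
  have hset : {z : ℕ → Torus n | z 0 = x} =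
      Preorder.frestrictLe (π := fun _ => Torus n) 0 ⁻¹' {fun _ => x} := by
    ext z
    simp only [Set.mem_ofPred_eq, Set.mem_preimage, Set.mem_singleton_iff, funext_iff,
      Preorder.frestrictLe_apply, Subtype.forall, Finset.mem_Iic, Nat.le_zero, forall_eq]
  have hm : Measurable (Preorder.frestrictLe (π := fun _ => Torus n) 0) := by fun_prop
  rw [hset, ← Measure.map_apply hm (measurableSet_singleton _), uniformWalkLaw,
    Kernel.trajMeasure, Measure.map_comp _ _ hm, Kernel.traj_map_frestrictLe,
    Kernel.partialTraj_self, Measure.id_comp, Measure.map_apply (by fun_prop)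
      (measurableSet_singleton _)]
  congr 1
  ext y
  simp only [Set.mem_preimage, Set.mem_singleton_iff]
  constructor
  · intro h
    exact congrFun h ⟨0, by simp⟩
  · rintro rfl
    ext i j
    rfl

end Law

end TorusWalk
namespace TorusWalk

/-! ### Exchanging the roles of the walks. -/

section Closeness

theorem integrable_listMean {S Ω : Type*} [Fintype S] [MeasurableSpace Ω] {μ : Measure Ω} (T : ℕ)
    {f : List S → Ω → ℝ} (hf : ∀ l, Integrable (f l) μ) :
    Integrable (fun ω => listMean T fun l => f l ω) μ := by
  induction T generalizing f with
  | zero => exact hf []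
  | succ T ih =>
    simp only [listMean]
    exact (integrable_finsetSum _ fun s _ => ih fun l => hf _).div_const _

theorem integral_listMean {S Ω : Type*} [Fintype S] [MeasurableSpace Ω] {μ : Measure Ω} (T : ℕ)
    {f : List S → Ω → ℝ} (hf : ∀ l, Integrable (f l) μ) :
    ∫ ω, listMean T (fun l => f l ω) ∂μ = listMean T fun l => ∫ ω, f l ω ∂μ := by
  induction T generalizing f with
  | zero => rfl
  | succ T ih =>
    simp only [listMean]
    rw [integral_div, integral_finsetSum _ fun s _ => integrable_listMean T fun l => hf _]
    simp only [ih fun l => hf _]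

variable {n : ℕ} [NeZero n]

open Classical in
theorem closeness_toReal (M : ℕ) (U V : Set (Torus n)) :
    (closeness n M U V).toReal =
      (∑ x, listMean M fun l =>
        if (∃ y ∈ visited (torusStep n) x l, y ∈ U) ∧ ∃ y ∈ visited (torusStep n) x l, y ∈ V
        then (1 : ℝ) else 0) / Fintype.card (Torus n) := by
  have hm : MeasurableSet {z : ℕ → Torus n | ∃ s t, s ≤ M ∧ t ≤ M ∧ z t ∈ U ∧ z s ∈ V} := by
    have : {z : ℕ → Torus n | ∃ s t, s ≤ M ∧ t ≤ M ∧ z t ∈ U ∧ z s ∈ V} =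
        ⋃ s, ⋃ t, ⋃ (_ : s ≤ M), ⋃ (_ : t ≤ M),
          (fun z : ℕ → Torus n => z t) ⁻¹' U ∩ (fun z : ℕ → Torus n => z s) ⁻¹' V := by
      ext z
      simp only [Set.mem_ofPred_eq, Set.mem_iUnion, exists_prop, Set.mem_inter_iff,
        Set.mem_preimage]
    rw [this]
    exact MeasurableSet.iUnion fun s => MeasurableSet.iUnion fun t => MeasurableSet.iUnion fun _ =>
      MeasurableSet.iUnion fun _ =>
        ((measurable_pi_apply t) U.toFinite.measurableSet).inter
          ((measurable_pi_apply s) V.toFinite.measurableSet)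
  have h := uniformWalkLaw_isWalk.real_event (n := n) M
    (E := fun z => ∃ s t, s ≤ M ∧ t ≤ M ∧ z t ∈ U ∧ z s ∈ V) (fun p q hpq => by
      refine exists_congr fun s => exists_congr fun t => ?_
      refine and_congr_right fun hs => and_congr_right fun ht => ?_
      rw [hpq s hs, hpq t ht]) hm
  rw [closeness, ← measureReal_def, h]
  simp only [uniformWalkLaw_real_zero]
  rw [← Finset.mul_sum, one_div_mul_eq_div]
  congr 1
  refine Finset.sum_congr rfl fun x _ => ?_
  refine listMean_congr fun l hl => ?_
  congr 1
  refine propext ⟨?_, ?_⟩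
  · rintro ⟨s, t, hs, ht, hU, hV⟩
    exact ⟨⟨_, (mem_visited _).2 ⟨t, hl ▸ ht, rfl⟩, hU⟩, ⟨_, (mem_visited _).2 ⟨s, hl ▸ hs, rfl⟩, hV⟩⟩
  · rintro ⟨⟨y, hy, hU⟩, ⟨y', hy', hV⟩⟩
    obtain ⟨t, ht, rfl⟩ := (mem_visited _).1 hy
    obtain ⟨s, hs, rfl⟩ := (mem_visited _).1 hy'
    exact ⟨s, t, hl ▸ hs, hl ▸ ht, hU, hV⟩

variable {Ω : Type*} [MeasurableSpace Ω] {μ : Measure Ω} [IsProbabilityMeasure μ]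

/-- Fubini: once the start and the steps of `Z` are fixed, its range `A` is deterministic and only
the probability that both random sets meet `A` is needed. -/
theorem lintegral_closeness_le (M : ℕ) {U V : Ω → Set (Torus n)}
    (hU : ∀ y, MeasurableSet {ω | y ∈ U ω}) (hV : ∀ y, MeasurableSet {ω | y ∈ V ω})
    {Φ : Finset (Torus n) → ℝ}
    (hΦ : ∀ A : Finset (Torus n), μ.real {ω | (∃ y ∈ A, y ∈ U ω) ∧ ∃ y ∈ A, y ∈ V ω} ≤ Φ A) :
    ∫⁻ ω, closeness n M (U ω) (V ω) ∂μ ≤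
      ENNReal.ofReal (listMean M (fun l => ∑ x, Φ (visited (torusStep n) x l)) /
        Fintype.card (Torus n)) := by
  classical
  have hmeas : ∀ A : Finset (Torus n),
      MeasurableSet {ω | (∃ y ∈ A, y ∈ U ω) ∧ ∃ y ∈ A, y ∈ V ω} := by
    intro A
    have : {ω | (∃ y ∈ A, y ∈ U ω) ∧ ∃ y ∈ A, y ∈ V ω} =
        (⋃ y ∈ A, {ω | y ∈ U ω}) ∩ ⋃ y ∈ A, {ω | y ∈ V ω} := by
      ext ω; simp
    rw [this]
    exact (A.measurableSet_biUnion fun y _ => hU y).inter (A.measurableSet_biUnion fun y _ => hV y)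
  have hind : ∀ A : Finset (Torus n), (fun ω => if (∃ y ∈ A, y ∈ U ω) ∧ ∃ y ∈ A, y ∈ V ω
      then (1 : ℝ) else 0) =
      {ω | (∃ y ∈ A, y ∈ U ω) ∧ ∃ y ∈ A, y ∈ V ω}.indicator fun _ => (1 : ℝ) := by
    intro A; ext ω; simp [Set.indicator_apply]
  have hint : ∀ A : Finset (Torus n), Integrable (fun ω =>
      if (∃ y ∈ A, y ∈ U ω) ∧ ∃ y ∈ A, y ∈ V ω then (1 : ℝ) else 0) μ := by
    intro A
    rw [hind]
    exact (integrable_const 1).indicator (hmeas A)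
  have hreal : ∀ ω, closeness n M (U ω) (V ω) =
      ENNReal.ofReal (closeness n M (U ω) (V ω)).toReal := fun ω =>
    (ENNReal.ofReal_toReal (measure_ne_top _ _)).symm
  have hsum : ∀ x, Integrable (fun ω => listMean M fun l =>
      if (∃ y ∈ visited (torusStep n) x l, y ∈ U ω) ∧ ∃ y ∈ visited (torusStep n) x l, y ∈ V ω
        then (1 : ℝ) else 0) μ := fun x => integrable_listMean M fun l => hint _
  have hInt : Integrable (fun ω => (closeness n M (U ω) (V ω)).toReal) μ := by
    simp only [closeness_toReal]
    exact (integrable_finsetSum _ fun x _ => hsum x).div_const _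
  rw [lintegral_congr hreal, ← ofReal_integral_eq_lintegral_ofReal hInt
    (Filter.Eventually.of_forall fun _ => ENNReal.toReal_nonneg)]
  refine ENNReal.ofReal_le_ofReal ?_
  simp only [closeness_toReal]
  rw [integral_div, integral_finsetSum _ fun x _ => hsum x, listMean_sum]
  gcongr with x
  rw [integral_listMean M fun l => hint _]
  refine listMean_mono fun l _ => ?_
  rw [hind, integral_indicator_const _ (hmeas _), smul_eq_mul, mul_one]
  exact hΦ _

/-- Moving the target uniformly while fixing the starting point amounts to fixing the target and
starting uniformly. This is why the initial law of `X` does not matter. -/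
theorem sum_hitProb_visited (K : ℕ) (x₀ : Torus n) (l : List Step) :
    ∑ x, hitProb (torusStep n) (visited (torusStep n) x l) K x₀ =
      Fintype.card (Torus n) * meanHit (torusStep n) K (visited (torusStep n) 0 l) := by
  have h : ∀ x, hitProb (torusStep n) (visited (torusStep n) x l) K x₀ =
      hitProb (torusStep n) (visited (torusStep n) 0 l) K (x₀ - x) := by
    intro x
    conv_lhs => rw [← sub_add_cancel x₀ x]
    refine hitProb_translate _ K _ x fun y => ?_
    rw [← mem_visited_add, zero_add]
  have := Equiv.sum_comp (Equiv.subLeft x₀)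
    (hitProb (torusStep n) (visited (torusStep n) 0 l) K)
  simp only [Equiv.subLeft_apply] at this
  have hN : (Fintype.card (Torus n) : ℝ) ≠ 0 := by exact_mod_cast Fintype.card_ne_zero
  simp only [h]
  rw [this, meanHit]
  field_simp

theorem sum_real_start {X : ℕ → Ω → Torus n} (hX : IsWalk n X μ) :
    ∑ x, μ.real {ω | X 0 ω = x} = 1 := by
  have h := hX.integral_path 0 (F := fun _ => 1) (fun _ _ _ => rfl)
  simpa [listMean] using h.symm

theorem lintegral_closeness_le_of_hitProb {X : ℕ → Ω → Torus n} (hX : IsWalk n X μ) (K L M : ℕ)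
    {U V : Ω → Set (Torus n)}
    (hU : ∀ y, MeasurableSet {ω | y ∈ U ω}) (hV : ∀ y, MeasurableSet {ω | y ∈ V ω})
    (hΦ : ∀ A : Finset (Torus n), μ.real {ω | (∃ y ∈ A, y ∈ U ω) ∧ ∃ y ∈ A, y ∈ V ω} ≤
      3 / 2 * ((∑ x, μ.real {ω | X 0 ω = x} * hitProb (torusStep n) A K x) *
        meanHit (torusStep n) L A)) :
    ∫⁻ ω, closeness n M (U ω) (V ω) ∂μ ≤
      ENNReal.ofReal (3 / 2 * listMean M (fun l =>
        meanHit (torusStep n) K (visited (torusStep n) 0 l) *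
          meanHit (torusStep n) L (visited (torusStep n) 0 l))) := by
  refine (lintegral_closeness_le M hU hV hΦ).trans (le_of_eq ?_)
  congr 1
  rw [← listMean_div_const, ← listMean_const_mul]
  refine listMean_congr fun l _ => ?_
  simp only [meanHit_visited (torusStep n) L _ l, ← Finset.mul_sum, ← Finset.sum_mul]
  rw [Finset.sum_comm]
  simp only [← Finset.mul_sum, sum_hitProb_visited]
  rw [← Finset.sum_mul, sum_real_start hX]
  have hN : (Fintype.card (Torus n) : ℝ) ≠ 0 := by exact_mod_cast Fintype.card_ne_zero
  field_simp

end Closeness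

/-! ### Hitting by two segments: independence and mixing. -/

section Segments

variable {n : ℕ}

/-- The event that a path visits `A` between the times `a` and `b`. -/
def PathHits (A : Finset (Torus n)) (a b : ℕ) (p : ℕ → Torus n) : Prop :=
  ∃ t, a ≤ t ∧ t ≤ b ∧ p t ∈ A

theorem exists_mem_segment_iff {Ω : Type*} {X : ℕ → Ω → Torus n} {A : Finset (Torus n)} {a b : ℕ} {ω : Ω} :
    (∃ y ∈ A, y ∈ segment X a b ω) ↔ PathHits A a b (fun t => X t ω) := by
  constructor
  · rintro ⟨y, hy, t, h1, h2, rfl⟩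
    exact ⟨t, h1, h2, hy⟩
  · rintro ⟨t, h1, h2, hy⟩
    exact ⟨_, hy, t, h1, h2, rfl⟩

theorem pathHits_congr {A : Finset (Torus n)} {a b T : ℕ} (hb : b ≤ T) {p q : ℕ → Torus n}
    (h : ∀ i ≤ T, p i = q i) : PathHits A a b p ↔ PathHits A a b q := by
  refine exists_congr fun t => and_congr_right fun _ => and_congr_right fun ht => ?_
  rw [h t (ht.trans hb)]

theorem pathHits_walkPos_iff {A : Finset (Torus n)} {x : Torus n} {l : List Step} :
    PathHits A 0 l.length (fun k => x + walkPos (torusStep n) l k) ↔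
      ¬ Disjoint (visited (torusStep n) x l) A := by
  simp only [PathHits, zero_le, true_and, Finset.not_disjoint_iff, mem_visited]
  constructor
  · rintro ⟨t, ht, hA⟩
    exact ⟨_, ⟨t, ht, rfl⟩, hA⟩
  · rintro ⟨_, ⟨t, ht, rfl⟩, hA⟩
    exact ⟨t, ht, hA⟩

theorem measurableSet_pathHits (A : Finset (Torus n)) (a b : ℕ) :
    MeasurableSet {p : ℕ → Torus n | PathHits A a b p} := by
  have : {p : ℕ → Torus n | PathHits A a b p} =
      ⋃ t, ⋃ (_ : a ≤ t), ⋃ (_ : t ≤ b), (fun p : ℕ → Torus n => p t) ⁻¹' A := by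
    ext p
    simp only [PathHits, Set.mem_ofPred_eq, Set.mem_iUnion, exists_prop, Set.mem_preimage,
      Finset.mem_coe]
  rw [this]
  exact MeasurableSet.iUnion fun t => MeasurableSet.iUnion fun _ => MeasurableSet.iUnion fun _ =>
    measurable_pi_apply t A.finite_toSet.measurableSet

variable [NeZero n] {Ω : Type*} [MeasurableSpace Ω] {μ : Measure Ω}

theorem IsWalk.measurableSet_mem_segment {X : ℕ → Ω → Torus n} (hX : IsWalk n X μ) (a b : ℕ)
    (y : Torus n) : MeasurableSet {ω | y ∈ segment X a b ω} := by
  have : {ω | y ∈ segment X a b ω} = ⋃ t, ⋃ (_ : a ≤ t), ⋃ (_ : t ≤ b), X t ⁻¹' {y} := by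
    ext ω
    simp only [segment, Set.mem_ofPred_eq, Set.mem_iUnion, exists_prop, Set.mem_preimage,
      Set.mem_singleton_iff]
  rw [this]
  exact MeasurableSet.iUnion fun t => MeasurableSet.iUnion fun _ => MeasurableSet.iUnion fun _ =>
    hX.measurable t (measurableSet_singleton y)

theorem IsWalk.measurable_path {X : ℕ → Ω → Torus n} (hX : IsWalk n X μ) :
    Measurable fun ω t => X t ω := measurable_pi_lambda _ hX.measurable

variable [IsProbabilityMeasure μ]

theorem IsWalk.real_pathHits {X : ℕ → Ω → Torus n} (hX : IsWalk n X μ) (A : Finset (Torus n))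
    (K : ℕ) : μ.real {ω | PathHits A 0 K fun t => X t ω} =
      ∑ x, μ.real {ω | X 0 ω = x} * hitProb (torusStep n) A K x := by
  classical
  rw [hX.real_event K (fun p q h => pathHits_congr le_rfl h)
    (hX.measurable_path (measurableSet_pathHits A 0 K))]
  refine Finset.sum_congr rfl fun x _ => ?_
  congr 1
  refine listMean_congr fun l hl => ?_
  subst hl
  simp only [pathHits_walkPos_iff, meet, ite_not]

theorem real_pathHits_inter_of_indepFun {X Y : ℕ → Ω → Torus n} (hX : IsWalk n X μ)
    (hY : IsWalk n Y μ) (hXY : IndepFun (fun ω t => X t ω) (fun ω t => Y t ω) μ)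
    (hY0 : μ.map (Y 0) = uniformOn Set.univ) (A : Finset (Torus n)) (K L : ℕ) :
    μ.real {ω | (PathHits A 0 K fun t => X t ω) ∧ PathHits A 0 L fun t => Y t ω} =
      (∑ x, μ.real {ω | X 0 ω = x} * hitProb (torusStep n) A K x) *
        meanHit (torusStep n) L A := by
  have h := hXY.measure_inter_preimage_eq_mul _ _ (measurableSet_pathHits A 0 K)
    (measurableSet_pathHits A 0 L)
  have hstart : ∀ x, μ.real {ω | Y 0 ω = x} = 1 / Fintype.card (Torus n) := by
    intro x
    rw [← uniformOn_real_singleton x, ← hY0, measureReal_def, measureReal_def,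
      Measure.map_apply (hY.measurable 0) (measurableSet_singleton x)]
    rfl
  have h2 := congrArg ENNReal.toReal h
  rw [ENNReal.toReal_mul] at h2
  refine h2.trans ?_
  congr 1
  · exact hX.real_pathHits A K
  · refine (hY.real_pathHits A L).trans ?_
    simp only [hstart, ← Finset.mul_sum, meanHit]
    ring

theorem exists_transProb_le_of_mixingTime_le {u : ℕ} (hu : mixingTime n ≤ u) :
    ∃ t ≤ u, ∀ x : Torus n, transProb n t 0 x ≤ 3 / (2 * (n : ℝ) ^ 4) := by
  by_contra! H
  have h : ((u + 1 : ℕ) : ℕ∞) ≤ mixingTime n := by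
    refine le_iInf₂ fun t ht => ?_
    by_contra hlt
    have htu : t ≤ u := by
      have : t < u + 1 := by exact_mod_cast not_le.1 hlt
      omega
    obtain ⟨x, hx⟩ := H t htu
    have := (abs_le.1 (ht x)).2
    have e : 1 / (n : ℝ) ^ 4 + 1 / (2 * (n : ℝ) ^ 4) = 3 / (2 * (n : ℝ) ^ 4) := by
      have : (n : ℝ) ≠ 0 := by exact_mod_cast NeZero.ne n
      field_simp; norm_num
    linarith
  have := h.trans hu
  have : u + 1 ≤ u := by exact_mod_cast this
  omega

/-- At some time `t ≤ u` the transition probabilities from 0, and by translation from any point, are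
at most 3/2 times uniform. -/
theorem listMean_le_of_mixingTime_le {u : ℕ} (hu : mixingTime n ≤ u) {φ : Torus n → ℝ}
    (hφ : ∀ y, 0 ≤ φ y) (z : Torus n) :
    listMean u (fun l => φ (z + (l.map (torusStep n)).sum)) ≤
      3 / 2 * ((∑ y, φ y) / Fintype.card (Torus n)) := by
  obtain ⟨t, ht, hmix⟩ := exists_transProb_le_of_mixingTime_le hu
  have hn : (n : ℝ) ≠ 0 := by exact_mod_cast NeZero.ne n
  have key : ∀ w : Torus n, listMean t (fun l => φ (w + (l.map (torusStep n)).sum)) ≤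
      3 / 2 * ((∑ y, φ y) / Fintype.card (Torus n)) := by
    intro w
    have h1 : ∀ l : List Step, φ (w + (l.map (torusStep n)).sum) =
        ∑ y, (if 0 + (l.map (torusStep n)).sum = y - w then 1 else 0) * φ y := by
      intro l
      simp [eq_sub_iff_add_eq']
    simp only [h1]
    rw [listMean_sum]
    simp only [listMean_mul_const, ← transProb_eq]
    calc ∑ y, transProb n t 0 (y - w) * φ y ≤ ∑ y, 3 / (2 * (n : ℝ) ^ 4) * φ y := by
          gcongr with y
          · exact hφ y
          · exact hmix _
      _ = _ := by
          rw [← Finset.mul_sum, card_torus]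
          push_cast
          field_simp
  -- The surplus `d` steps are taken first: they only move the starting point, and the bound for the
  -- last `t` steps is uniform in it.
  obtain ⟨d, rfl⟩ := Nat.exists_eq_add_of_le' ht
  rw [listMean_append]
  rw [← listMean_const (S := Step) d (3 / 2 * ((∑ y, φ y) / Fintype.card (Torus n)))]
  refine listMean_mono fun l _ => ?_
  simpa [add_assoc] using key (z + (l.map (torusStep n)).sum)

/-- Split the steps into pieces of lengths `K`, `u` and `L`. Given the first piece, the middle one
nearly equidistributes the start of the last, so the second hitting probability is at most 3/2 times
`meanHit`. -/
theorem real_pathHits_inter_le_of_mixingTime_le {X : ℕ → Ω → Torus n} (hX : IsWalk n X μ)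
    (A : Finset (Torus n)) (K L u : ℕ) (hu : mixingTime n ≤ u) :
    μ.real {ω | (PathHits A 0 K fun t => X t ω) ∧
        PathHits A (K + u) (K + L + u) fun t => X t ω} ≤
      3 / 2 * ((∑ x, μ.real {ω | X 0 ω = x} * hitProb (torusStep n) A K x) *
        meanHit (torusStep n) L A) := by
  classical
  rw [hX.real_event (K + (u + L))
    (E := fun p => PathHits A 0 K p ∧ PathHits A (K + u) (K + L + u) p)
    (fun p q h => and_congr (pathHits_congr (by omega) h) (pathHits_congr (by omega) h))
    ((hX.measurable_path (measurableSet_pathHits A 0 K)).inter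
      (hX.measurable_path (measurableSet_pathHits A (K + u) (K + L + u)))),
    Finset.sum_mul, Finset.mul_sum]
  refine Finset.sum_le_sum fun x _ => ?_
  refine (mul_le_mul_of_nonneg_left (c := hitProb (torusStep n) A K x *
    (3 / 2 * meanHit (torusStep n) L A)) ?_ measureReal_nonneg).trans (le_of_eq (by ring))
  rw [listMean_append]
  calc _ ≤ listMean K (fun l => meet (visited (torusStep n) x l) A *
        listMean u (fun l' => hitProb (torusStep n) A L
          (x + (l.map (torusStep n)).sum + (l'.map (torusStep n)).sum))) := by
        refine listMean_mono fun l hl => ?_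
        rw [listMean_append, ← listMean_const_mul]
        refine listMean_mono fun l' hl' => ?_
        rw [hitProb, ← listMean_const_mul]
        refine listMean_mono fun l'' hl'' => ?_
        split_ifs with h
        · obtain ⟨⟨t, _, ht, htA⟩, ⟨s, hs1, hs2, hsA⟩⟩ := h
          beta_reduce at htA hsA
          rw [meet_eq_one ((mem_visited _).2 ⟨t, hl ▸ ht, rfl⟩)
            (by rwa [walkPos_append_left _ _ (hl ▸ ht)] at htA), one_mul]
          obtain ⟨r, rfl⟩ := Nat.exists_eq_add_of_le hs1
          rw [meet_eq_one ((mem_visited _).2 ⟨r, by omega, rfl⟩)]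
          rw [add_assoc, ← hl, walkPos_append_right, ← hl', walkPos_append_right] at hsA
          simpa only [add_assoc] using hsA
        · exact mul_nonneg (meet_nonneg _ _) (meet_nonneg _ _)
    _ ≤ listMean K (fun l => meet (visited (torusStep n) x l) A *
          (3 / 2 * meanHit (torusStep n) L A)) := by
        refine listMean_mono fun l _ => ?_
        refine mul_le_mul_of_nonneg_left ?_ (meet_nonneg _ _)
        exact listMean_le_of_mixingTime_le hu (φ := hitProb (torusStep n) A L)
          (hitProb_nonneg _ _ _) (x + (l.map (torusStep n)).sum)
    _ = _ := by rw [listMean_mul_const, hitProb]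

end Segments

end TorusWalk
-- The two closeness bounds.
theorem mainTheorem9 (C' : ℝ) (hC' : 0 < C') :
    ∃ C : ℝ, 0 < C ∧
      ∀ (n : ℕ) [NeZero n], 2 ≤ n →
      ∀ (Ω : Type*) [MeasurableSpace Ω] (μ : Measure Ω) [IsProbabilityMeasure μ]
        (X Y : ℕ → Ω → TorusWalk.Torus n),
        TorusWalk.IsWalk n X μ → TorusWalk.IsWalk n Y μ →
        IndepFun (fun ω t => X t ω) (fun ω t => Y t ω) μ →
        μ.map (Y 0) = uniformOn Set.univ →
      ∀ K L M u : ℕ,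
        C' * n * Real.log n ≤ K → C' * n * Real.log n ≤ L → C' * n * Real.log n ≤ M →
        TorusWalk.mixingTime n ≤ (u : ℕ∞) →
        ∫⁻ ω, TorusWalk.closeness n M (TorusWalk.segment X 0 K ω)
            (TorusWalk.segment Y 0 L ω) ∂μ
          ≤ ENNReal.ofReal (C * K * L * (M : ℝ) ^ 2 / ((n : ℝ) ^ 8 * Real.log n ^ 2)) ∧
        ∫⁻ ω, TorusWalk.closeness n M (TorusWalk.segment X 0 K ω)
            (TorusWalk.segment X (K + u) (K + L + u) ω) ∂μ
          ≤ ENNReal.ofReal (C * K * L * (M : ℝ) ^ 2 / ((n : ℝ) ^ 8 * Real.log n ^ 2)) := by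
  obtain ⟨C, hC, hbound⟩ := TorusWalk.exists_listMean_meanHit_bound C' hC'
  refine ⟨3 / 2 * C, by positivity, ?_⟩
  intro n _ hn Ω _ μ _ X Y hX hY hXY hY0 K L M u hK hL hM hu
  have key := hbound (TorusWalk.Torus n) (TorusWalk.toTorus n) n hn TorusWalk.card_torus
    K L M hK hL hM
  have hle : ENNReal.ofReal (3 / 2 * TorusWalk.listMean M (fun l =>
      TorusWalk.meanHit (TorusWalk.torusStep n) K
        (TorusWalk.visited (TorusWalk.torusStep n) 0 l) *
      TorusWalk.meanHit (TorusWalk.torusStep n) L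
        (TorusWalk.visited (TorusWalk.torusStep n) 0 l))) ≤
      ENNReal.ofReal (3 / 2 * C * K * L * (M : ℝ) ^ 2 / ((n : ℝ) ^ 8 * Real.log n ^ 2)) := by
    refine ENNReal.ofReal_le_ofReal ((mul_le_mul_of_nonneg_left key (by norm_num)).trans
      (le_of_eq ?_))
    ring
  constructor
  · refine le_trans (TorusWalk.lintegral_closeness_le_of_hitProb hX K L M
      (hX.measurableSet_mem_segment 0 K) (hY.measurableSet_mem_segment 0 L) fun A => ?_) hle
    simp only [TorusWalk.exists_mem_segment_iff]
    rw [TorusWalk.real_pathHits_inter_of_indepFun hX hY hXY hY0]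
    -- In the independent case the product formula is exact; the factor 3/2 is admitted only to
    -- share the bound with the mixing case.
    refine le_mul_of_one_le_left (mul_nonneg (Finset.sum_nonneg fun x _ => ?_)
      (TorusWalk.meanHit_nonneg ..)) (by norm_num)
    exact mul_nonneg measureReal_nonneg (TorusWalk.hitProb_nonneg ..)
  · refine le_trans (TorusWalk.lintegral_closeness_le_of_hitProb hX K L M
      (hX.measurableSet_mem_segment 0 K) (hX.measurableSet_mem_segment (K + u) (K + L + u))
      fun A => ?_) hle
    simp only [TorusWalk.exists_mem_segment_iff]
    exact TorusWalk.real_pathHits_inter_le_of_mixingTime_le hX A K L u hu
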